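/- Let $n, D$ be natural numbers, let $f=(f_1,\dots,f_D):\mathbb R^D\to(\mathbb R^n)^D$ be continuous, and let $u_0\in L^1(\mathbb R^n;\mathbb R^D)\cap L^\infty(\mathbb R^n;\mathbb R^D)$. Let $u(x,t)\in\mathbb R^D$, $x\in\mathbb R^n$, $t\ge 0$, with $u(\cdot,0)=u_0$ a.e., be a weak solution of $\partial_t u_i+\nabla\cdot f_i(u)=0$, $i=1,\dots,D$; that is, $u$ and $f(u)$ are locally integrable on $\mathbb R^n\times[0,\infty)$ and, for every bounded open $G\subseteq\mathbb R^n$, all $0\le t_1<t_2$ and all $\phi_1,\dots,\phi_D\in C_c^\infty(G\times(t_1,t_2))$, $$\sum_{i=1}^D\int_{t_1}^{t_2}\int_G\big[u_i\,\partial_t\phi_i+f_i(u)\cdot\nabla_x\phi_i\big]\,dx\,dt=0 .$$ Assume that $u$ is (essentially) bounded on bounded subsets of $\mathbb R^n\times[0,\infty)$ and that, for every bounded domain $G\subseteq\mathbb R^n$, the mass $\int_G u(x,t)\,dx$ is well defined for every $t\ge0$ and continuous in $t\in[0,\infty)$. Let $\Omega\subseteq\mathbb R^n$ be a bounded open set with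 smooth boundary and outward unit normal $\nu$. For $y\in\mathbb R$ let $\Gamma_y=\{x+y\,\nu(x):x\in\partial\Omega\}$; let $\Omega_y=\Omega\cup\bigcup_{0\le s<y}\Gamma_s$ if $y\ge0$ and $\Omega_y=\Omega\setminus\bigcup_{y\le s<0}\Gamma_s$ if $y<0$. Call an interval $(a,b)$ with $a<0<b$ admissible if, for $y\in(a,b)$, the $\Omega_y$ are bounded open sets with smooth boundary $\partial\Omega_y=\Gamma_y$, with $\overline{\Omega_y}\subseteq\Omega_z$ for $y<z$, the set $\bigcup_{y\in(a,b)}\Gamma_y$ is open, $x+y\,\nu(x)\mapsto y$ ($x\in\partial\Omega$, $y\in(a,b)$) is a well-defined smooth function on it, and the outward unit normal of $\Omega_y$ at $x+y\,\nu(x)$ is $\nu(x)$. Then $(-\delta,\delta)$ is admissible for some $\delta\in(0,1)$. Moreover, for every admissible interval $(a,b)$ and all $0\le t_1<t_2$, the flux trace $h=(h_1,\dots,h_D)$, $$h_i(y;t_1,t_2)=\int_{t_1}^{t_2}\Big[\int_{\Gamma_y}f_i(u(x,t))\cdot\nu\,dS_y\Big]dt,$$ where $\nu$ is the outward unit normal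 of $\Omega_y$ on $\Gamma_y$ and $dS_y$ is the surface measure on $\Gamma_y$, is well defined (the integrand is integrable on $\Gamma_y\times[t_1,t_2]$) for a.e. $y\in(a,b)$; it is Lipschitz continuous in $y$ on $(a,b)$, in the sense that it agrees for a.e. $y\in(a,b)$ with a Lipschitz continuous function on $(a,b)$; and its distributional derivative with respect to $y$ on $(a,b)$ is a function in $L^\infty((a,b);\mathbb R^D)$. -/

import Mathlib

open Set MeasureTheory Topology
open scoped ContDiff Gradient MeasureTheory

noncomputable section

/-! ### Smooth bounded domains and their outward unit normals -/

/-- `ρ` is a local defining function of `Ω` near `p`: on some open neighbourhood `U` of `p` it is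
smooth, has nowhere vanishing gradient, and `Ω ∩ U = {ρ < 0} ∩ U`
(hence `∂Ω ∩ U = {ρ = 0} ∩ U`). -/
def IsLocalDefiningFunction {n : ℕ} (Ω : Set (EuclideanSpace ℝ (Fin n)))
    (p : EuclideanSpace ℝ (Fin n)) (ρ : EuclideanSpace ℝ (Fin n) → ℝ) : Prop :=
  ∃ U : Set (EuclideanSpace ℝ (Fin n)), IsOpen U ∧ p ∈ U ∧ ContDiffOn ℝ ∞ ρ U ∧
    (∀ x ∈ U, ∇ ρ x ≠ 0) ∧ ∀ x ∈ U, (x ∈ Ω ↔ ρ x < 0)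

/-- A bounded open set with smooth boundary, lying locally on one side of it.
Connectedness is not required, so that connected domains are a special case. -/
structure IsSmoothBoundedDomain {n : ℕ} (Ω : Set (EuclideanSpace ℝ (Fin n))) : Prop where
  isOpen : IsOpen Ω
  isBounded : Bornology.IsBounded Ω
  smooth_boundary : ∀ p ∈ frontier Ω, ∃ ρ, IsLocalDefiningFunction Ω p ρ

open Classical in
/-- The outward unit normal `∇ρ / |∇ρ|` of `Ω` at a boundary point `p`, where `ρ` is any local
defining function near `p` (the value does not depend on which one);
`0` if there is no local defining function. -/
def outwardNormal {n : ℕ} (Ω : Set (EuclideanSpace ℝ (Fin n)))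
    (p : EuclideanSpace ℝ (Fin n)) : EuclideanSpace ℝ (Fin n) :=
  if h : ∃ ρ, IsLocalDefiningFunction Ω p ρ then ‖∇ h.choose p‖⁻¹ • ∇ h.choose p else 0

/-! ### The parallel hypersurfaces and the tubular neighbourhood -/

/-- The parallel hypersurface `Γ_y = {x + y ν(x) : x ∈ ∂Ω}`. -/
def parallelSurface {n : ℕ} (Ω : Set (EuclideanSpace ℝ (Fin n))) (y : ℝ) :
    Set (EuclideanSpace ℝ (Fin n)) :=
  (fun x => x + y • outwardNormal Ω x) '' frontier Ω

/-- The domain `Ω_y`: for `y ≥ 0` the surfaces `Γ_s`, `0 ≤ s < y`, are added to `Ω`; for `y < 0`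
the surfaces `Γ_s`, `y ≤ s < 0`, are removed from `Ω`. -/
def parallelDomain {n : ℕ} (Ω : Set (EuclideanSpace ℝ (Fin n))) (y : ℝ) :
    Set (EuclideanSpace ℝ (Fin n)) :=
  (Ω \ ⋃ s ∈ Ico y 0, parallelSurface Ω s) ∪ ⋃ s ∈ Ico 0 y, parallelSurface Ω s

/-- The tube `⋃ Γ_y`, `y ∈ (a, b)`. -/
def parallelTube {n : ℕ} (Ω : Set (EuclideanSpace ℝ (Fin n))) (a b : ℝ) :
    Set (EuclideanSpace ℝ (Fin n)) :=
  ⋃ y ∈ Ioo a b, parallelSurface Ω y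

/-- The interval `(a, b) ∋ 0` is admissible for the tubular neighbourhood construction at `∂Ω`:
the `Ω_y`, `y ∈ (a, b)`, are expanding smooth bounded domains with boundaries `Γ_y`, the surfaces
`Γ_y` foliate the open tube, with `y` as a smooth coordinate on it, and the coordinate direction
`∂/∂y` is the outward unit normal of `Γ_y`. -/
structure IsTubularFoliation {n : ℕ} (Ω : Set (EuclideanSpace ℝ (Fin n))) (a b : ℝ) : Prop where
  left_neg : a < 0
  right_pos : 0 < b
  smooth_domain : ∀ y ∈ Ioo a b, IsSmoothBoundedDomain (parallelDomain Ω y)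
  boundary : ∀ y ∈ Ioo a b, frontier (parallelDomain Ω y) = parallelSurface Ω y
  expanding : ∀ y ∈ Ioo a b, ∀ z ∈ Ioo a b, y < z →
    closure (parallelDomain Ω y) ⊆ parallelDomain Ω z
  isOpen_tube : IsOpen (parallelTube Ω a b)
  coordinate : ∃ Y : EuclideanSpace ℝ (Fin n) → ℝ, ContDiffOn ℝ ∞ Y (parallelTube Ω a b) ∧
    ∀ x ∈ frontier Ω, ∀ y ∈ Ioo a b, Y (x + y • outwardNormal Ω x) = y
  normal : ∀ x ∈ frontier Ω, ∀ y ∈ Ioo a b,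
    outwardNormal (parallelDomain Ω y) (x + y • outwardNormal Ω x) = outwardNormal Ω x

/-! ### Weak solutions of the system of conservation laws -/

/-- `u` is a weak solution of `∂ₜ uᵢ + ∇ · fᵢ(u) = 0`, `i = 1, …, D`, on `ℝⁿ × (0, ∞)`: `u` and
`f(u)` are locally integrable on `ℝⁿ × [0, ∞)`, and for every cylinder `Ω × [t₁, t₂]`, `t₁ ≥ 0`,
the weak formulation holds for all smooth test functions with compact support inside it. -/
def IsWeakSolution {n D : ℕ}
    (f : EuclideanSpace ℝ (Fin D) → Fin D → EuclideanSpace ℝ (Fin n))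
    (u : EuclideanSpace ℝ (Fin n) → ℝ → EuclideanSpace ℝ (Fin D)) : Prop :=
  LocallyIntegrableOn (fun p : EuclideanSpace ℝ (Fin n) × ℝ => u p.1 p.2)
    (univ ×ˢ Ici (0 : ℝ)) volume ∧
  (∀ i, LocallyIntegrableOn (fun p : EuclideanSpace ℝ (Fin n) × ℝ => f (u p.1 p.2) i)
    (univ ×ˢ Ici (0 : ℝ)) volume) ∧
  ∀ (Ω : Set (EuclideanSpace ℝ (Fin n))) (t₁ t₂ : ℝ),
    IsOpen Ω → Bornology.IsBounded Ω → 0 ≤ t₁ → t₁ < t₂ →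
    ∀ φ : Fin D → EuclideanSpace ℝ (Fin n) × ℝ → ℝ,
      (∀ i, ContDiff ℝ ∞ (φ i)) → (∀ i, HasCompactSupport (φ i)) →
      (∀ i, tsupport (φ i) ⊆ Ω ×ˢ Ioo t₁ t₂) →
      ∑ i, ∫ t in t₁..t₂, ∫ x in Ω,
        (u x t i * deriv (fun s => φ i (x, s)) t
          + inner ℝ (f (u x t) i) (∇ (fun z => φ i (z, t)) x)) = 0

/-- `u` is (essentially) locally bounded in `ℝⁿ × [0, ∞)`. -/
def IsLocallyBounded {n D : ℕ}
    (u : EuclideanSpace ℝ (Fin n) → ℝ → EuclideanSpace ℝ (Fin D)) : Prop :=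
  ∀ R T : ℝ, ∃ C : ℝ, ∀ᵐ p : EuclideanSpace ℝ (Fin n) × ℝ
    ∂(volume.restrict (Metric.closedBall 0 R ×ˢ Icc 0 T)), ‖u p.1 p.2‖ ≤ C

/-- For every bounded domain `Ω` the mass `m(t) = ∫_Ω u(x, t) dx` is well defined for every
`t ≥ 0` and is a continuous function of `t ∈ [0, ∞)`. -/
def HasContinuousMass {n D : ℕ}
    (u : EuclideanSpace ℝ (Fin n) → ℝ → EuclideanSpace ℝ (Fin D)) : Prop :=
  ∀ Ω : Set (EuclideanSpace ℝ (Fin n)), IsOpen Ω → IsConnected Ω → Bornology.IsBounded Ω →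
    (∀ t, 0 ≤ t → IntegrableOn (fun x => u x t) Ω volume) ∧
    ContinuousOn (fun t => ∫ x in Ω, u x t) (Ici 0)

/-! ### The flux trace -/

/-- The flux density `fᵢ(u(x, t)) · ν(x)` on the hypersurface `Γ_y`, where `ν` is the outward unit
normal of `Ω_y`. -/
def fluxDensity {n D : ℕ}
    (f : EuclideanSpace ℝ (Fin D) → Fin D → EuclideanSpace ℝ (Fin n))
    (u : EuclideanSpace ℝ (Fin n) → ℝ → EuclideanSpace ℝ (Fin D))
    (Ω : Set (EuclideanSpace ℝ (Fin n))) (y : ℝ) (i : Fin D)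
    (x : EuclideanSpace ℝ (Fin n)) (t : ℝ) : ℝ :=
  inner ℝ (f (u x t) i) (outwardNormal (parallelDomain Ω y) x)

/-- The surface measure `dS_y` on `Γ_y`: the `(n-1)`-dimensional Hausdorff measure, normalized to
be Lebesgue measure on `ℝⁿ⁻¹`, restricted to `Γ_y`. -/
def surfaceMeasure {n : ℕ} (Ω : Set (EuclideanSpace ℝ (Fin n))) (y : ℝ) :
    Measure (EuclideanSpace ℝ (Fin n)) :=
  (μHE[n - 1] : Measure (EuclideanSpace ℝ (Fin n))).restrict (parallelSurface Ω y)

/-- The flux trace `h(y; t₁, t₂) ∈ ℝᴰ`, with components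
`hᵢ(y; t₁, t₂) = ∫_{t₁}^{t₂} [∫_{Γ_y} fᵢ(u(x, t)) · ν dS_y] dt`. -/
def fluxTrace {n D : ℕ}
    (f : EuclideanSpace ℝ (Fin D) → Fin D → EuclideanSpace ℝ (Fin n))
    (u : EuclideanSpace ℝ (Fin n) → ℝ → EuclideanSpace ℝ (Fin D))
    (Ω : Set (EuclideanSpace ℝ (Fin n))) (t₁ t₂ y : ℝ) : EuclideanSpace ℝ (Fin D) :=
  WithLp.toLp 2 fun i => ∫ t in t₁..t₂, ∫ x, fluxDensity f u Ω y i x t ∂(surfaceMeasure Ω y)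

end

/-! Everything on the tube is expressed through the normal coordinate `Y`, which equals y on Γ_y.
Both `Y` and a defining function of Ω_y are constant along ∂Ω_y, so their gradients are parallel,
and `Y` grows at unit speed along the normals; hence ∇Y = ν and |∇Y| = 1
(`IsTubularFoliation.gradient_coordinate`). The coarea formula for `Y` therefore has no Jacobian: dx
= dS_y dy on the tube (`IsNormalCoordinate.bind_kernel`). Existence of the flux trace for a.e. y is
then Fubini.

Testing the equation with θ(Y(x)) 1_[t₁,t₂](t), whose spatial gradient is θ'(Y) ν, and slicing by
`Y` gives ∫ θ' h dy = -∫ θ r dy with r(y) = ∫_{Γ_y} (u(·,t₁) - u(·,t₂)) dS_y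
(`IsNormalCoordinate.integral_deriv_smul_fluxTrace`). So r is the weak derivative of h. It is
bounded, because u is bounded and the areas of the Γ_y are uniformly bounded
(`IsNormalCoordinate.exists_surfaceMeasure_le`). By the du Bois-Reymond lemma
`ae_eq_primitive_of_weak_deriv`, h is a.e. a primitive of r, hence Lipschitz.

The sharp time cutoff needs care, since u is controlled only almost everywhere in space-time.
Continuity of the mass on balls and Lebesgue differentiation carry the essential bound to every time
slice (`exists_bound_forall_time`); with that bound, the mass against any integrable weight is
continuous in time (`continuousOn_integral_smul`). The du Bois-Reymond lemma in t then yields the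
balance law between the exact times t₁ and t₂ (`IsWeakSolution.integral_sub_integral_eq`).

The coarea formula comes from straightening `Y` locally by maps that are almost isometries. An
admissible interval comes from the inverse function theorem at each boundary point, made uniform by
a Lebesgue number. -/

noncomputable section

/-! ### Coarea formula for functions with unit gradient. -/

section Coarea

open scoped NNReal ENNReal

theorem LipschitzOnWith.euclideanHausdorffMeasure_image_le {X X' : Type*}
    [EMetricSpace X] [MeasurableSpace X] [BorelSpace X]
    [EMetricSpace X'] [MeasurableSpace X'] [BorelSpace X'] {K : ℝ≥0} {f : X → X'} {s : Set X}
    (h : LipschitzOnWith K f s) (d : ℕ) :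
    (μHE[d] : Measure X') (f '' s) ≤ (K : ℝ≥0∞) ^ d * (μHE[d] : Measure X) s := by
  have := h.hausdorffMeasure_image_le (d := (d : ℝ)) (by positivity)
  rw [ENNReal.rpow_natCast] at this
  simp only [Measure.euclideanHausdorffMeasure_def, Measure.smul_apply, ENNReal.smul_def,
    smul_eq_mul]
  calc _ ≤ _ * ((K : ℝ≥0∞) ^ d * μH[d] s) := by gcongr
    _ = _ := by ring

theorem euclideanHausdorffMeasure_le_image {X X' : Type*} [Nonempty X]
    [EMetricSpace X] [MeasurableSpace X] [BorelSpace X]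
    [EMetricSpace X'] [MeasurableSpace X'] [BorelSpace X'] {K : ℝ≥0} {f : X → X'} {s : Set X}
    (h : ∀ x ∈ s, ∀ y ∈ s, edist x y ≤ K * edist (f x) (f y)) (d : ℕ) :
    (μHE[d] : Measure X) s ≤ (K : ℝ≥0∞) ^ d * (μHE[d] : Measure X') (f '' s) := by
  have hinj : InjOn f s := fun x hx y hy hxy => by
    have := h x hx y hy
    rw [hxy, edist_self, mul_zero] at this
    exact edist_le_zero.mp this
  have hL : LipschitzOnWith K (Function.invFunOn f s) (f '' s) := by
    rintro _ ⟨x, hx, rfl⟩ _ ⟨y, hy, rfl⟩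
    rw [hinj.leftInvOn_invFunOn hx, hinj.leftInvOn_invFunOn hy]
    exact h x hx y hy
  have := hL.euclideanHausdorffMeasure_image_le d
  rwa [hinj.invFunOn_image subset_rfl] at this

theorem coe_mk'_orthogonal_span_singleton {V : Type*} [NormedAddCommGroup V]
    [InnerProductSpace ℝ V] {v : V} (hv : ‖v‖ = 1) (y : ℝ) :
    (AffineSubspace.mk' (y • v +ᵥ (0 : V)) (ℝ ∙ v)ᗮ : Set V) = {x | inner ℝ v x = y} := by
  ext x
  simp only [SetLike.mem_coe, AffineSubspace.mem_mk', Submodule.mem_orthogonal_singleton_iff_inner_right,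
    mem_ofPred_eq, vadd_eq_add, add_zero, vsub_eq_sub, inner_sub_right, inner_smul_right,
    real_inner_self_eq_norm_sq, hv]
  constructor <;> intro h <;> linarith

variable {V : Type*} [NormedAddCommGroup V] [InnerProductSpace ℝ V] [FiniteDimensional ℝ V]
  [MeasurableSpace V] [BorelSpace V]

theorem lintegral_euclideanHausdorffMeasure_hyperplane {v : V} (hv : ‖v‖ = 1) {t : Set V}
    (ht : MeasurableSet t) :
    ∫⁻ y : ℝ, (μHE[Module.finrank ℝ V - 1] : Measure V) (t ∩ {x | inner ℝ v x = y}) =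
      volume t := by
  have := EuclideanGeometry.euclideanHausdorffMeasure_eq_lintegral (0 : V)
    (v := v) (by rintro rfl; simp at hv) ht
  rw [InnerProductSpace.euclideanHausdorffMeasure_eq_volume] at this
  rw [this, ← ofReal_norm, hv]
  simp [← coe_mk'_orthogonal_span_singleton hv]

/-- Translation identifies the slice at height y with the y-section of a measurable subset of ℝ ×
vᗮ, and section measures are measurable by Tonelli. -/
theorem measurable_euclideanHausdorffMeasure_hyperplane {v : V} (hv : ‖v‖ = 1) {t : Set V}
    (ht : MeasurableSet t) :
    Measurable fun y : ℝ =>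
      (μHE[Module.finrank ℝ V - 1] : Measure V) (t ∩ {x | inner ℝ v x = y}) := by
  have hv0 : v ≠ 0 := by rintro rfl; simp at hv
  have hrank : Module.finrank ℝ (ℝ ∙ v)ᗮ = Module.finrank ℝ V - 1 := by
    rw [← (ℝ ∙ v).finrank_add_finrank_orthogonal, finrank_span_singleton hv0,
      Nat.add_sub_cancel_left]
  let s : Set (ℝ × (ℝ ∙ v)ᗮ) := (fun q => q.1 • v + (q.2 : V)) ⁻¹' t
  have hs : MeasurableSet s := ht.preimage (by fun_prop)
  have hm := measurable_measure_prodMk_left (ν := (volume : Measure (ℝ ∙ v)ᗮ)) hs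
  convert hm using 2 with y
  rw [← InnerProductSpace.euclideanHausdorffMeasure_eq_volume, hrank]
  have hiso : Isometry (fun w : (ℝ ∙ v)ᗮ => y • v + (w : V)) :=
    (isometry_add_left (y • v)).comp isometry_subtype_coe
  rw [← hiso.euclideanHausdorffMeasure_image]
  congr 1
  ext x
  simp only [mem_inter_iff, mem_ofPred_eq, mem_image, mem_preimage, s]
  constructor
  · rintro ⟨hx, hxy⟩
    refine ⟨⟨x - y • v, ?_⟩, by simpa using hx, by simp⟩
    rw [Submodule.mem_orthogonal_singleton_iff_inner_right, inner_sub_right, inner_smul_right,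
      real_inner_self_eq_norm_sq, hv, hxy]
    ring
  · rintro ⟨w, hw, rfl⟩
    refine ⟨hw, ?_⟩
    have := Submodule.mem_orthogonal_singleton_iff_inner_right.mp w.2
    rw [inner_add_right, inner_smul_right, real_inner_self_eq_norm_sq, hv, this]
    ring

/-- The coarea formula on `A`, up to a multiplicative error `C`. -/
def IsCoareaApprox (Y : V → ℝ) (C : ℝ≥0∞) (A : Set V) : Prop :=
  ∃ g : ℝ → ℝ≥0∞, Measurable g ∧
    (∀ y, g y ≤ C * (μHE[Module.finrank ℝ V - 1] : Measure V) (A ∩ Y ⁻¹' {y})) ∧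
    (∀ y, (μHE[Module.finrank ℝ V - 1] : Measure V) (A ∩ Y ⁻¹' {y}) ≤ C * g y) ∧
    ∫⁻ y, g y ≤ C * volume A ∧ volume A ≤ C * ∫⁻ y, g y

/-- All four bounds are linear in the measures and share the constant `C`, so they add over disjoint
pieces. The measurable `g` stands in for the slice measure, whose own measurability is only obtained
later. -/
theorem IsCoareaApprox.iUnion {Y : V → ℝ} {C : ℝ≥0∞} {A : ℕ → Set V}
    (hA : ∀ k, MeasurableSet (A k)) (hd : Pairwise (Function.onFun Disjoint A))
    (h : ∀ k, IsCoareaApprox Y C (A k)) : IsCoareaApprox Y C (⋃ k, A k) := by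
  choose g hg h1 h2 h3 h4 using h
  have hsum : ∀ y, (μHE[Module.finrank ℝ V - 1] : Measure V) ((⋃ k, A k) ∩ Y ⁻¹' {y}) =
      ∑' k, (μHE[Module.finrank ℝ V - 1] : Measure V) (A k ∩ Y ⁻¹' {y}) := fun y => by
    rw [← Measure.restrict_apply (MeasurableSet.iUnion hA), measure_iUnion hd hA]
    simp_rw [Measure.restrict_apply (hA _)]
  have hint : ∫⁻ y, ∑' k, g k y = ∑' k, ∫⁻ y, g k y :=
    lintegral_tsum fun k => (hg k).aemeasurable
  refine ⟨fun y => ∑' k, g k y, Measurable.tsum hg, fun y => ?_, fun y => ?_, ?_, ?_⟩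
  · rw [hsum, ← ENNReal.tsum_mul_left]
    exact ENNReal.tsum_le_tsum fun k => h1 k y
  · rw [hsum, ← ENNReal.tsum_mul_left]
    exact ENNReal.tsum_le_tsum fun k => h2 k y
  · rw [hint, measure_iUnion hd hA, ← ENNReal.tsum_mul_left]
    exact ENNReal.tsum_le_tsum h3
  · rw [hint, measure_iUnion hd hA, ← ENNReal.tsum_mul_left]
    exact ENNReal.tsum_le_tsum h4

/-- With v = ∇Y(p), the map F(x) = x + (Y(x) - ⟨v, x⟩) v has derivative the identity at p, and ⟨v,
F(x)⟩ = Y(x) because |v| = 1. Near p it is thus bi-Lipschitz with constant close to 1 and carries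
level sets of `Y` into parallel hyperplanes, where the formula is Fubini. -/
theorem exists_isCoareaApprox_nhds {Y : V → ℝ} {p : V} (hY : ContDiffAt ℝ 1 Y p)
    (hp : ‖∇ Y p‖ = 1) {C : ℝ≥0} (hC : 1 < C) :
    ∃ B, IsOpen B ∧ p ∈ B ∧ ∀ A ⊆ B, MeasurableSet A → IsCoareaApprox Y C A := by
  set v := ∇ Y p with hv
  set m := Module.finrank ℝ V
  let F : V → V := fun x => x + (Y x - inner ℝ v x) • v
  have hF : HasStrictFDerivAt F (ContinuousLinearMap.id ℝ V) p := by
    have h1 : HasStrictFDerivAt Y (innerSL ℝ v) p := by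
      have := (hY.differentiableAt one_ne_zero).hasGradientAt.hasFDerivAt
      have h2 := hY.hasStrictFDerivAt (by norm_num)
      rwa [this.fderiv] at h2
    have h2 : HasStrictFDerivAt (fun x : V => inner ℝ v x) (innerSL ℝ v) p :=
      (innerSL ℝ v).hasStrictFDerivAt
    have := (hasStrictFDerivAt_id p).add ((h1.sub h2).smul_const v)
    convert this using 1
    · rfl
    · rw [sub_self]; ext; simp
  -- A `K`-Lipschitz map distorts d-dimensional measure by at most K^d; the exponent m covers both d
  -- = m and d = m - 1.
  obtain ⟨K, hK1, hKm⟩ : ∃ K : ℝ≥0, 1 < K ∧ K ^ m ≤ C := by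
    have ht : Filter.Tendsto (fun K : ℝ≥0 => K ^ m) (𝓝[>] 1) (𝓝 1) := by
      have : Filter.Tendsto (fun K : ℝ≥0 => K ^ m) (𝓝 1) (𝓝 (1 ^ m)) :=
        (continuous_pow m).tendsto 1
      rw [one_pow] at this
      exact this.mono_left nhdsWithin_le_nhds
    obtain ⟨K, hK, hK'⟩ := ((ht.eventually_lt_const hC).and self_mem_nhdsWithin).exists
    exact ⟨K, hK', hK.le⟩
  -- radius of approximation
  set c : ℝ≥0 := 1 - K⁻¹ with hc
  have hKinv : K⁻¹ < 1 := inv_lt_one_of_one_lt₀ hK1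
  have hc0 : 0 < c := tsub_pos_of_lt hKinv
  have hcr : (c : ℝ) = 1 - (K : ℝ)⁻¹ := by rw [hc, NNReal.coe_sub hKinv.le]; simp
  obtain ⟨s, hs, happ⟩ := hF.approximates_deriv_on_nhds (c := c) (Or.inr hc0)
  obtain ⟨B₁, hB₁s, hB₁o, hpB₁⟩ := mem_nhds_iff.mp hs
  obtain ⟨s₂, hs₂, hYs₂⟩ := hY.contDiffOn le_rfl (by simp)
  obtain ⟨B₂, hB₂s, hB₂o, hpB₂⟩ := mem_nhds_iff.mp (by simpa using hs₂ : s₂ ∈ 𝓝 p)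
  have hK1' : (1 : ℝ) < K := by exact_mod_cast hK1
  have hlip : ∀ x ∈ s, ∀ y ∈ s, edist (F x) (F y) ≤ K * edist x y := fun x hx y hy => by
    have h := happ x hx y hy
    rw [edist_nndist, edist_nndist, ← ENNReal.coe_mul, ENNReal.coe_le_coe, ← NNReal.coe_le_coe]
    push_cast
    rw [dist_eq_norm, dist_eq_norm]
    have h2 : ‖F x - F y‖ ≤ ‖F x - F y - (x - y)‖ + ‖x - y‖ := by
      simpa using norm_add_le (F x - F y - (x - y)) (x - y)
    have h3 : ‖F x - F y - (x - y)‖ ≤ c * ‖x - y‖ := by simpa using h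
    -- The choice c = 1 - 1/K makes the lower bound 1 - c equal to 1/K exactly; the upper bound 2 -
    -- 1/K ≤ K amounts to (K - 1)² ≥ 0.
    have h4 : 1 + (c : ℝ) ≤ K := by
      rw [hcr]
      have : (K : ℝ) * (K : ℝ)⁻¹ = 1 := mul_inv_cancel₀ (by positivity)
      nlinarith [inv_pos.mpr (zero_lt_one.trans hK1'), sq_nonneg ((K : ℝ) - 1)]
    nlinarith [norm_nonneg (x - y)]
  have hanti : ∀ x ∈ s, ∀ y ∈ s, edist x y ≤ K * edist (F x) (F y) := fun x hx y hy => by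
    have h := happ x hx y hy
    rw [edist_nndist, edist_nndist, ← ENNReal.coe_mul, ENNReal.coe_le_coe, ← NNReal.coe_le_coe]
    push_cast
    rw [dist_eq_norm, dist_eq_norm]
    have h2 : ‖x - y‖ ≤ ‖F x - F y - (x - y)‖ + ‖F x - F y‖ := by
      have := norm_sub_le (F x - F y) (F x - F y - (x - y))
      rw [sub_sub_cancel] at this
      linarith
    have h3 : ‖F x - F y - (x - y)‖ ≤ c * ‖x - y‖ := by simpa using h
    rw [hcr] at h3
    have h4 : (K : ℝ)⁻¹ * ‖x - y‖ ≤ ‖F x - F y‖ := by nlinarith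
    rwa [inv_mul_le_iff₀ (by positivity)] at h4
  have hinj : InjOn F s := fun x hx y hy hxy => by
    have := hanti x hx y hy
    rw [hxy, edist_self, mul_zero] at this
    exact edist_le_zero.mp this
  have hpow : ∀ d ≤ m, (K : ℝ≥0∞) ^ d ≤ C := fun d hd => by
    rw [← ENNReal.coe_pow, ENNReal.coe_le_coe]
    exact (pow_le_pow_right₀ hK1.le hd).trans hKm
  have hFY : ∀ x, inner ℝ v (F x) = Y x := fun x => by
    simp only [F, inner_add_right, inner_smul_right, real_inner_self_eq_norm_sq, hp]
    ring
  refine ⟨B₁ ∩ B₂, hB₁o.inter hB₂o, ⟨hpB₁, hpB₂⟩, fun A hA hAm => ?_⟩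
  have hAs : A ⊆ s := fun x hx => hB₁s (hA hx).1
  have hFc : ContinuousOn F A := by
    have : ContinuousOn Y A := hYs₂.continuousOn.mono fun x hx => hB₂s (hA hx).2
    fun_prop
  have hFA : MeasurableSet (F '' A) := hAm.image_of_continuousOn_injOn hFc (hinj.mono hAs)
  have himg : ∀ y, F '' A ∩ {x | inner ℝ v x = y} = F '' (A ∩ Y ⁻¹' {y}) := fun y => by
    ext z
    constructor
    · rintro ⟨⟨x, hx, rfl⟩, hz⟩
      exact ⟨x, ⟨hx, by rw [mem_ofPred_eq, hFY] at hz; exact hz⟩, rfl⟩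
    · rintro ⟨x, ⟨hx, hxy⟩, rfl⟩
      exact ⟨⟨x, hx, rfl⟩, by rw [mem_ofPred_eq, hFY]; exact hxy⟩
  have up : ∀ d ≤ m, ∀ S ⊆ s, (μHE[d] : Measure V) (F '' S) ≤ C * (μHE[d] : Measure V) S :=
    fun d hd S hS => by
      have hL : LipschitzOnWith K F S := fun x hx y hy => hlip x (hS hx) y (hS hy)
      exact (hL.euclideanHausdorffMeasure_image_le d).trans (by gcongr; exact hpow d hd)
  have dn : ∀ d ≤ m, ∀ S ⊆ s, (μHE[d] : Measure V) S ≤ C * (μHE[d] : Measure V) (F '' S) :=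
    fun d hd S hS =>
      (euclideanHausdorffMeasure_le_image (fun x hx y hy => hanti x (hS hx) y (hS hy)) d).trans
        (by gcongr; exact hpow d hd)
  refine ⟨fun y => (μHE[m - 1] : Measure V) (F '' A ∩ {x | inner ℝ v x = y}),
    measurable_euclideanHausdorffMeasure_hyperplane hp hFA, fun y => ?_, fun y => ?_, ?_, ?_⟩
  · simp only [himg]
    exact up _ (Nat.sub_le _ _) _ (inter_subset_left.trans hAs)
  · simp only [himg]
    exact dn _ (Nat.sub_le _ _) _ (inter_subset_left.trans hAs)
  · rw [lintegral_euclideanHausdorffMeasure_hyperplane hp hFA,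
      ← InnerProductSpace.euclideanHausdorffMeasure_eq_volume]
    exact up _ le_rfl _ hAs
  · rw [lintegral_euclideanHausdorffMeasure_hyperplane hp hFA,
      ← InnerProductSpace.euclideanHausdorffMeasure_eq_volume]
    exact dn _ le_rfl _ hAs

/-- By the Lindelöf property countably many of the local neighbourhoods cover `A`; made disjoint,
they cut it into pieces to which the local estimate applies. -/
theorem isCoareaApprox_of_norm_gradient_eq_one {Y : V → ℝ} {U : Set V} (hU : IsOpen U)
    (hY : ContDiffOn ℝ 1 Y U) (hgrad : ∀ x ∈ U, ‖∇ Y x‖ = 1) {C : ℝ≥0} (hC : 1 < C)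
    {A : Set V} (hA : MeasurableSet A) (hAU : A ⊆ U) : IsCoareaApprox Y C A := by
  rcases A.eq_empty_or_nonempty with rfl | hne
  · exact ⟨0, measurable_zero, by simp⟩
  have h : ∀ p : V, ∃ B, IsOpen B ∧ (p ∈ U → p ∈ B) ∧
      ∀ A ⊆ B, MeasurableSet A → IsCoareaApprox Y C A := fun p => by
    by_cases hp : p ∈ U
    · obtain ⟨B, hB, hpB, h⟩ :=
        exists_isCoareaApprox_nhds (hY.contDiffAt (hU.mem_nhds hp)) (hgrad p hp) hC
      exact ⟨B, hB, fun _ => hpB, h⟩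
    · exact ⟨∅, isOpen_empty, fun h => absurd h hp, fun A hA _ => by
        rw [subset_empty_iff.mp hA]
        exact ⟨0, measurable_zero, by simp⟩⟩
  choose B hBo hpB hB using h
  obtain ⟨T, hTc, hT⟩ := TopologicalSpace.isOpen_iUnion_countable B hBo
  have hTne : T.Nonempty := by
    by_contra hne'
    rw [not_nonempty_iff_eq_empty.mp hne'] at hT
    obtain ⟨x, hx⟩ := hne
    have : x ∈ ⋃ i, B i := mem_iUnion.mpr ⟨x, hpB x (hAU hx)⟩
    rw [← hT] at this
    simp at this
  obtain ⟨e, he⟩ := hTc.exists_eq_range hTne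
  have hcov : A = ⋃ k, disjointed (fun k => B (e k)) k ∩ A := by
    rw [← iUnion_inter, iUnion_disjointed, eq_comm, inter_eq_right]
    intro x hx
    have : x ∈ ⋃ i, B i := mem_iUnion.mpr ⟨x, hpB x (hAU hx)⟩
    rw [← hT, he] at this
    simpa using this
  have hm : ∀ k, MeasurableSet (disjointed (fun k => B (e k)) k ∩ A) := fun k =>
    (MeasurableSet.disjointed (fun k => (hBo (e k)).measurableSet) k).inter hA
  rw [hcov]
  refine IsCoareaApprox.iUnion hm (fun i j hij => ?_) fun k => hB (e k) _ ?_ (hm k)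
  · exact ((disjoint_disjointed _ hij).mono inter_subset_left inter_subset_left)
  · exact inter_subset_left.trans (disjointed_subset _ _)

theorem ENNReal.le_of_forall_one_lt_le_mul {x y : ℝ≥0∞}
    (h : ∀ C : ℝ≥0, 1 < C → x ≤ C * (C * y)) : x ≤ y := by
  have ht : Filter.Tendsto (fun C : ℝ≥0 => (C : ℝ≥0∞) * C) (𝓝[>] 1) (𝓝 (((1 : ℝ≥0) * (1 : ℝ≥0) : ℝ≥0) : ℝ≥0∞)) := by
    simp_rw [← ENNReal.coe_mul]
    refine ENNReal.tendsto_coe.mpr (Filter.Tendsto.mono_left ?_ nhdsWithin_le_nhds)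
    exact (continuous_id.mul continuous_id).tendsto (1 : ℝ≥0)
  have ht' := ENNReal.Tendsto.mul_const (b := y) ht (Or.inl (by simp))
  simp only [mul_one, ENNReal.coe_one, one_mul] at ht'
  refine ge_of_tendsto ht' ?_
  filter_upwards [self_mem_nhdsWithin] with C hC
  rw [mul_assoc]
  exact h C hC

/-- Coarea formula for a function with unit gradient: measurability. -/
theorem measurable_euclideanHausdorffMeasure_levelSet {Y : V → ℝ} {U : Set V} (hU : IsOpen U)
    (hY : ContDiffOn ℝ 1 Y U) (hgrad : ∀ x ∈ U, ‖∇ Y x‖ = 1)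
    {A : Set V} (hA : MeasurableSet A) (hAU : A ⊆ U) :
    Measurable fun y => (μHE[Module.finrank ℝ V - 1] : Measure V) (A ∩ Y ⁻¹' {y}) := by
  have hC : ∀ k : ℕ, (1 : ℝ≥0) < 1 + 1 / (k + 1) := fun k => by
    simp only [lt_add_iff_pos_right]; positivity
  choose g hg h1 h2 _ _ using fun k : ℕ =>
    isCoareaApprox_of_norm_gradient_eq_one hU hY hgrad (hC k) hA hAU
  -- The slice measure is squeezed between g_k / C_k and C_k g_k with C_k ↓ 1, so it is a countable
  -- infimum of measurable functions.
  have : (fun y => (μHE[Module.finrank ℝ V - 1] : Measure V) (A ∩ Y ⁻¹' {y})) =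
      fun y => ⨅ k : ℕ, ((1 + 1 / (k + 1) : ℝ≥0) : ℝ≥0∞) * g k y := by
    ext y
    refine le_antisymm (le_iInf fun k => h2 k y) (ENNReal.le_of_forall_one_lt_le_mul fun C hC1 => ?_)
    obtain ⟨k, hk⟩ := exists_nat_one_div_lt (tsub_pos_of_lt hC1)
    have hk' : (1 + 1 / (k + 1) : ℝ≥0) ≤ C := by
      have := add_le_add_right hk.le 1
      rwa [add_tsub_cancel_of_le hC1.le] at this
    refine (iInf_le _ k).trans ((mul_le_mul_right (h1 k y) _).trans ?_)
    gcongr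
  rw [this]
  exact Measurable.iInf fun k => (hg k).const_mul _

/-- Coarea formula for a function with unit gradient. -/
theorem lintegral_euclideanHausdorffMeasure_levelSet {Y : V → ℝ} {U : Set V} (hU : IsOpen U)
    (hY : ContDiffOn ℝ 1 Y U) (hgrad : ∀ x ∈ U, ‖∇ Y x‖ = 1)
    {A : Set V} (hA : MeasurableSet A) (hAU : A ⊆ U) :
    ∫⁻ y, (μHE[Module.finrank ℝ V - 1] : Measure V) (A ∩ Y ⁻¹' {y}) = volume A := by
  refine le_antisymm (ENNReal.le_of_forall_one_lt_le_mul fun C hC => ?_)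
    (ENNReal.le_of_forall_one_lt_le_mul fun C hC => ?_) <;>
  obtain ⟨g, hg, h1, h2, h3, h4⟩ := isCoareaApprox_of_norm_gradient_eq_one hU hY hgrad hC hA hAU
  · calc _ ≤ ∫⁻ y, C * g y := lintegral_mono h2
      _ = C * ∫⁻ y, g y := lintegral_const_mul _ hg
      _ ≤ _ := by gcongr
  · calc _ ≤ C * ∫⁻ y, g y := h4
      _ ≤ C * ∫⁻ y, C * (μHE[Module.finrank ℝ V - 1] : Measure V) (A ∩ Y ⁻¹' {y}) := by
        gcongr with y; exact h1 y
      _ = _ := by rw [lintegral_const_mul' _ _ (by simp)]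

end Coarea

end

noncomputable section

/-! ### Defining functions, outward normals and the gradient of the normal coordinate. -/

section Normals

open Filter

section Gradient

variable {V : Type*} [NormedAddCommGroup V] [InnerProductSpace ℝ V] [CompleteSpace V]

theorem inner_gradient_eq_fderiv (f : V → ℝ) (x w : V) : inner ℝ (∇ f x) w = fderiv ℝ f x w := by
  simp [gradient]

/-- Lagrange multipliers; the multiplier of φ cannot vanish because ∇ρ(p) ≠ 0. -/
theorem exists_gradient_eq_smul_of_isLocalExtrOn {ρ φ : V → ℝ} {p : V} (hρ : ContDiffAt ℝ 1 ρ p)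
    (hφ : ContDiffAt ℝ 1 φ p) (hg : ∇ ρ p ≠ 0) (h : IsLocalExtrOn φ {x | ρ x = ρ p} p) :
    ∃ c : ℝ, ∇ φ p = c • ∇ ρ p := by
  obtain ⟨a, b, hab, h0⟩ := h.exists_multipliers_of_hasStrictFDerivAt_1d
    (hρ.hasStrictFDerivAt one_ne_zero) (hφ.hasStrictFDerivAt one_ne_zero)
  have h1 : a • ∇ ρ p + b • ∇ φ p = 0 := by
    apply ext_inner_right ℝ
    intro w
    rw [inner_add_left, real_inner_smul_left, real_inner_smul_left, inner_gradient_eq_fderiv,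
      inner_gradient_eq_fderiv, inner_zero_left]
    simpa using DFunLike.congr_fun h0 w
  have hb : b ≠ 0 := by
    rintro rfl
    rw [zero_smul, add_zero, smul_eq_zero] at h1
    rcases h1 with rfl | h1
    · exact hab rfl
    · exact hg h1
  refine ⟨-(b⁻¹ * a), ?_⟩
  have h2 : b • ∇ φ p = -(a • ∇ ρ p) := by rw [eq_neg_iff_add_eq_zero, add_comm]; exact h1
  rw [neg_smul, mul_smul, ← smul_neg, ← h2, smul_smul, inv_mul_cancel₀ hb, one_smul]

theorem hasDerivAt_comp_line {f : V → ℝ} {x w : V} {s : ℝ}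
    (hf : DifferentiableAt ℝ f (x + s • w)) :
    HasDerivAt (fun s : ℝ => f (x + s • w)) (inner ℝ (∇ f (x + s • w)) w) s := by
  have h1 : HasDerivAt (fun s : ℝ => x + s • w) w s := by
    simpa using ((hasDerivAt_id s).smul_const w).const_add x
  rw [inner_gradient_eq_fderiv]
  exact hf.hasFDerivAt.comp_hasDerivAt s h1

theorem eventually_comp_line_lt {f : V → ℝ} {x w : V} (hf : DifferentiableAt ℝ f x)
    (h : inner ℝ (∇ f x) w < 0) : ∀ᶠ s : ℝ in 𝓝[>] 0, f (x + s • w) < f x := by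
  have hd : HasDerivAt (fun s : ℝ => f (x + s • w)) (inner ℝ (∇ f x) w) 0 := by
    have := hasDerivAt_comp_line (f := f) (x := x) (w := w) (s := 0) (by simpa using hf)
    simpa using this
  have hs := (hasDerivAt_iff_tendsto_slope.mp hd).eventually_lt_const h
  have hs' : ∀ᶠ s : ℝ in 𝓝[>] 0, slope (fun s : ℝ => f (x + s • w)) 0 s < 0 :=
    hs.filter_mono (nhdsWithin_mono _ fun s hs => ne_of_gt hs)
  filter_upwards [hs', self_mem_nhdsWithin] with s h1 h2
  rw [slope_def_field] at h1
  simp only [zero_smul, add_zero, sub_zero] at h1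
  have h2' : 0 < s := h2
  rw [div_neg_iff] at h1
  rcases h1 with h1 | h1 <;> linarith

end Gradient

variable {n : ℕ} {Ω : Set (EuclideanSpace ℝ (Fin n))} {p : EuclideanSpace ℝ (Fin n)}
  {ρ : EuclideanSpace ℝ (Fin n) → ℝ}

theorem IsLocalDefiningFunction.contDiffAt (h : IsLocalDefiningFunction Ω p ρ) :
    ContDiffAt ℝ ∞ ρ p := by
  obtain ⟨U, hU, hp, hρ, -⟩ := h
  exact hρ.contDiffAt (hU.mem_nhds hp)

theorem IsLocalDefiningFunction.gradient_ne_zero (h : IsLocalDefiningFunction Ω p ρ) :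
    ∇ ρ p ≠ 0 := by
  obtain ⟨U, hU, hp, hρ, hg, -⟩ := h
  exact hg p hp

theorem IsLocalDefiningFunction.eventually_mem_iff (h : IsLocalDefiningFunction Ω p ρ) :
    ∀ᶠ x in 𝓝 p, x ∈ Ω ↔ ρ x < 0 := by
  obtain ⟨U, hU, hp, hρ, hg, h⟩ := h
  exact mem_of_superset (hU.mem_nhds hp) h

theorem IsLocalDefiningFunction.eventually (h : IsLocalDefiningFunction Ω p ρ) :
    ∀ᶠ x in 𝓝 p, IsLocalDefiningFunction Ω x ρ := by
  obtain ⟨U, hU, hp, h⟩ := h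
  exact mem_of_superset (hU.mem_nhds hp) fun x hx => ⟨U, hU, hx, h⟩

theorem IsLocalDefiningFunction.eq_zero (h : IsLocalDefiningFunction Ω p ρ)
    (hp : p ∈ frontier Ω) : ρ p = 0 := by
  have hc : ContinuousAt ρ p := h.contDiffAt.continuousAt
  rcases lt_trichotomy (ρ p) 0 with h0 | h0 | h0
  · refine absurd ?_ hp.2
    rw [mem_interior_iff_mem_nhds]
    filter_upwards [h.eventually_mem_iff, hc.eventually_lt_const h0] with x h1 h2
    exact h1.mpr h2
  · exact h0
  · refine absurd hp.1 ?_
    rw [mem_closure_iff_frequently, not_frequently]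
    filter_upwards [h.eventually_mem_iff, hc.eventually_const_lt h0] with x h1 h2
    rw [h1]; exact h2.le.not_gt

/-- Moving from p along -∇ρ makes ρ negative, hence enters Ω, while p itself is not in Ω. -/
theorem IsLocalDefiningFunction.mem_frontier (h : IsLocalDefiningFunction Ω p ρ)
    (hp : ρ p = 0) : p ∈ frontier Ω := by
  refine ⟨?_, fun hi => ?_⟩
  · have hneg : inner ℝ (∇ ρ p) (-∇ ρ p) < 0 := by
      rw [inner_neg_right, neg_lt_zero, real_inner_self_eq_norm_sq]
      have := norm_pos_iff.mpr h.gradient_ne_zero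
      positivity
    have h1 := eventually_comp_line_lt (h.contDiffAt.differentiableAt (by simp)) hneg
    have hline : Tendsto (fun s : ℝ => p + s • -∇ ρ p) (𝓝[>] 0) (𝓝 p) := by
      have : Continuous fun s : ℝ => p + s • -∇ ρ p := by fun_prop
      have := this.tendsto 0
      rw [zero_smul, add_zero] at this
      exact this.mono_left nhdsWithin_le_nhds
    refine mem_closure_of_tendsto hline ?_
    filter_upwards [h1, hline.eventually h.eventually_mem_iff] with s h2 h3
    rw [h3]; linarith
  · have := h.eventually_mem_iff.self_of_nhds.mp (interior_subset hi)
    linarith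

/-- The gradients of two local defining functions at a boundary point are positively
proportional. -/
theorem IsLocalDefiningFunction.exists_gradient_eq_smul {ρ' : EuclideanSpace ℝ (Fin n) → ℝ}
    (h : IsLocalDefiningFunction Ω p ρ) (h' : IsLocalDefiningFunction Ω p ρ')
    (hp : p ∈ frontier Ω) : ∃ c : ℝ, 0 < c ∧ ∇ ρ' p = c • ∇ ρ p := by
  have hρ := h.eq_zero hp
  have hρ' := h'.eq_zero hp
  -- Points near p with ρ = 0 are not in Ω, so ρ' ≥ 0 = ρ'(p) there: p is a constrained local
  -- minimum of ρ'.
  have hext : IsLocalExtrOn ρ' {x | ρ x = ρ p} p := by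
    left
    filter_upwards [mem_nhdsWithin_of_mem_nhds h.eventually_mem_iff,
      mem_nhdsWithin_of_mem_nhds h'.eventually_mem_iff, self_mem_nhdsWithin] with x h1 h2 h3
    replace h3 : ρ x = ρ p := h3
    rw [hρ] at h3
    rw [hρ']
    by_contra hlt
    have := h1.mp (h2.mpr (not_le.mp hlt))
    linarith
  obtain ⟨c, hc⟩ := exists_gradient_eq_smul_of_isLocalExtrOn (h.contDiffAt.of_le (by simp))
    (h'.contDiffAt.of_le (by simp)) h.gradient_ne_zero hext
  refine ⟨c, ?_, hc⟩
  have hpos := norm_pos_iff.mpr h.gradient_ne_zero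
  by_contra hc0
  rcases (not_lt.mp hc0).lt_or_eq with hc0 | hc0
  · have hneg : inner ℝ (∇ ρ p) (-∇ ρ p) < 0 := by
      rw [inner_neg_right, neg_lt_zero, real_inner_self_eq_norm_sq]
      positivity
    -- If c < 0, a small step along -∇ρ makes ρ negative and ρ' positive, so the point reached would
    -- be both inside and outside Ω.
    have hneg' : inner ℝ (∇ (-ρ') p) (-∇ ρ p) < 0 := by
      have : ∇ (-ρ') p = -∇ ρ' p := by simp [gradient, fderiv_neg]
      rw [this, hc, inner_neg_neg, real_inner_smul_left, real_inner_self_eq_norm_sq]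
      exact mul_neg_of_neg_of_pos hc0 (by positivity)
    have h1 := eventually_comp_line_lt (h.contDiffAt.differentiableAt (by simp)) hneg
    have h2 := eventually_comp_line_lt (h'.contDiffAt.differentiableAt (by simp)).neg hneg'
    have hline : Tendsto (fun s : ℝ => p + s • -∇ ρ p) (𝓝[>] 0) (𝓝 p) := by
      have : Continuous fun s : ℝ => p + s • -∇ ρ p := by fun_prop
      have := this.tendsto 0
      rw [zero_smul, add_zero] at this
      exact this.mono_left nhdsWithin_le_nhds
    obtain ⟨s, h1, h2, h3, h4⟩ := (h1.and (h2.and ((hline.eventually h.eventually_mem_iff).and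
      (hline.eventually h'.eventually_mem_iff)))).exists
    rw [hρ] at h1
    simp only [Pi.neg_apply, hρ'] at h2
    have := h4.mp (h3.mpr h1)
    linarith
  · rw [hc0, zero_smul] at hc
    exact h'.gradient_ne_zero hc

theorem IsLocalDefiningFunction.outwardNormal_eq (h : IsLocalDefiningFunction Ω p ρ)
    (hp : p ∈ frontier Ω) : outwardNormal Ω p = ‖∇ ρ p‖⁻¹ • ∇ ρ p := by
  have hex : ∃ ρ, IsLocalDefiningFunction Ω p ρ := ⟨ρ, h⟩
  obtain ⟨c, hc, h1⟩ := h.exists_gradient_eq_smul hex.choose_spec hp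
  have hpos := norm_pos_iff.mpr h.gradient_ne_zero
  rw [outwardNormal, dif_pos hex, h1, norm_smul, Real.norm_of_nonneg hc.le, smul_smul]
  congr 1
  field_simp

theorem norm_outwardNormal (hΩ : IsSmoothBoundedDomain Ω) (hp : p ∈ frontier Ω) :
    ‖outwardNormal Ω p‖ = 1 := by
  obtain ⟨ρ, h⟩ := hΩ.smooth_boundary p hp
  rw [h.outwardNormal_eq hp, norm_smul, norm_inv, norm_norm,
    inv_mul_cancel₀ (norm_ne_zero_iff.mpr h.gradient_ne_zero)]

theorem IsSmoothBoundedDomain.isCompact_frontier (hΩ : IsSmoothBoundedDomain Ω) :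
    IsCompact (frontier Ω) :=
  Metric.isCompact_of_isClosed_isBounded isClosed_frontier
    (hΩ.isBounded.closure.subset frontier_subset_closure)

@[simp]
theorem parallelSurface_zero : parallelSurface Ω 0 = frontier Ω := by
  simp [parallelSurface]

section Foliation

variable {a b : ℝ}

theorem parallelSurface_subset_tube {y : ℝ} (hy : y ∈ Ioo a b) :
    parallelSurface Ω y ⊆ parallelTube Ω a b :=
  subset_biUnion_of_mem (u := fun y => parallelSurface Ω y) hy

theorem add_smul_outwardNormal_mem_tube {x : EuclideanSpace ℝ (Fin n)} (hx : x ∈ frontier Ω)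
    {y : ℝ} (hy : y ∈ Ioo a b) : x + y • outwardNormal Ω x ∈ parallelTube Ω a b :=
  parallelSurface_subset_tube hy ⟨x, hx, rfl⟩

theorem exists_eq_of_mem_parallelTube {Y : EuclideanSpace ℝ (Fin n) → ℝ}
    (hY : ∀ x ∈ frontier Ω, ∀ y ∈ Ioo a b, Y (x + y • outwardNormal Ω x) = y)
    {z : EuclideanSpace ℝ (Fin n)} (hz : z ∈ parallelTube Ω a b) : Y z ∈ Ioo a b ∧
      ∃ x ∈ frontier Ω, z = x + Y z • outwardNormal Ω x := by
  simp only [parallelTube, mem_iUnion, exists_prop] at hz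
  obtain ⟨y, hy, x, hx, rfl⟩ := hz
  simp only [hY x hx y hy]
  exact ⟨hy, x, hx, rfl⟩

theorem parallelSurface_eq_tube_inter {Y : EuclideanSpace ℝ (Fin n) → ℝ}
    (hY : ∀ x ∈ frontier Ω, ∀ y ∈ Ioo a b, Y (x + y • outwardNormal Ω x) = y)
    {y : ℝ} (hy : y ∈ Ioo a b) : parallelSurface Ω y = parallelTube Ω a b ∩ Y ⁻¹' {y} := by
  apply Subset.antisymm
  · rintro _ ⟨x, hx, rfl⟩
    exact ⟨add_smul_outwardNormal_mem_tube hx hy, hY x hx y hy⟩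
  · rintro z ⟨hz, hzy⟩
    obtain ⟨-, x, hx, hzx⟩ := exists_eq_of_mem_parallelTube hY hz
    rw [show Y z = y from hzy] at hzx
    exact ⟨x, hx, hzx.symm⟩

/-- A closed slab of the tube is the continuous image of ∂Ω × [c, d] under (x, y) ↦ x + y ν(x). -/
theorem isCompact_parallelTube_inter_preimage (hc : IsCompact (frontier Ω))
    (hν : ContinuousOn (outwardNormal Ω) (frontier Ω)) {Y : EuclideanSpace ℝ (Fin n) → ℝ}
    (hY : ∀ x ∈ frontier Ω, ∀ y ∈ Ioo a b, Y (x + y • outwardNormal Ω x) = y)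
    {c d : ℝ} (hcd : Icc c d ⊆ Ioo a b) :
    IsCompact (parallelTube Ω a b ∩ Y ⁻¹' Icc c d) := by
  have himg : parallelTube Ω a b ∩ Y ⁻¹' Icc c d =
      (fun q : EuclideanSpace ℝ (Fin n) × ℝ => q.1 + q.2 • outwardNormal Ω q.1) ''
        (frontier Ω ×ˢ Icc c d) := by
    ext z
    constructor
    · rintro ⟨hz, hzy⟩
      obtain ⟨hy, x, hx, hzx⟩ := exists_eq_of_mem_parallelTube hY hz
      exact ⟨(x, Y z), ⟨hx, hzy⟩, hzx.symm⟩
    · rintro ⟨⟨x, y⟩, ⟨hx, hy⟩, rfl⟩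
      refine ⟨add_smul_outwardNormal_mem_tube hx (hcd hy), ?_⟩
      rw [mem_preimage, hY x hx y (hcd hy)]
      exact hy
  rw [himg]
  refine (hc.prod isCompact_Icc).image_of_continuousOn ?_
  have h1 : ContinuousOn (fun q : EuclideanSpace ℝ (Fin n) × ℝ => outwardNormal Ω q.1)
      (frontier Ω ×ˢ Icc c d) := hν.comp continuousOn_fst fun q hq => hq.1
  fun_prop

theorem isBounded_parallelTube (hc : IsCompact (frontier Ω))
    (hν : ∀ x ∈ frontier Ω, ‖outwardNormal Ω x‖ = 1) :
    Bornology.IsBounded (parallelTube Ω a b) := by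
  obtain ⟨R, hR⟩ := hc.isBounded.exists_norm_le
  refine isBounded_iff_forall_norm_le.mpr ⟨R + max (-a) b, fun z hz => ?_⟩
  simp only [parallelTube, mem_iUnion, exists_prop] at hz
  obtain ⟨y, hy, x, hx, rfl⟩ := hz
  refine (norm_add_le _ _).trans (add_le_add (hR x hx) ?_)
  rw [norm_smul, hν x hx, mul_one, Real.norm_eq_abs, abs_le]
  exact ⟨by linarith [hy.1, le_max_left (-a) b], by linarith [hy.2, le_max_right (-a) b]⟩

/-- Since `Y` is constant on ∂Ω_y = Γ_y, its gradient is a multiple of the gradient of a defining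
function of Ω_y, hence of ν. As Y(x + s ν) = s, the derivative along ν is 1, which fixes the factor.
-/
theorem IsTubularFoliation.gradient_coordinate (h : IsTubularFoliation Ω a b)
    {Y : EuclideanSpace ℝ (Fin n) → ℝ} (hYs : ContDiffOn ℝ ∞ Y (parallelTube Ω a b))
    (hY : ∀ x ∈ frontier Ω, ∀ y ∈ Ioo a b, Y (x + y • outwardNormal Ω x) = y)
    {x : EuclideanSpace ℝ (Fin n)} (hx : x ∈ frontier Ω) {y : ℝ} (hy : y ∈ Ioo a b) :
    ∇ Y (x + y • outwardNormal Ω x) = outwardNormal Ω x ∧ ‖outwardNormal Ω x‖ = 1 := by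
  set z := x + y • outwardNormal Ω x with hz
  have hzt : z ∈ parallelTube Ω a b := add_smul_outwardNormal_mem_tube hx hy
  have hYz : ContDiffAt ℝ ∞ Y z := hYs.contDiffAt (h.isOpen_tube.mem_nhds hzt)
  have hzf : z ∈ frontier (parallelDomain Ω y) := by
    rw [h.boundary y hy]; exact ⟨x, hx, rfl⟩
  obtain ⟨ρ, hρ⟩ := (h.smooth_domain y hy).smooth_boundary z hzf
  have hnorm := norm_outwardNormal (h.smooth_domain y hy) hzf
  have hnu := hρ.outwardNormal_eq hzf
  rw [h.normal x hx y hy] at hnorm hnu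
  refine ⟨?_, hnorm⟩
  have hext : IsLocalExtrOn Y {w | ρ w = ρ z} z := by
    left
    filter_upwards [mem_nhdsWithin_of_mem_nhds hρ.eventually, self_mem_nhdsWithin] with w h1 h2
    replace h2 : ρ w = ρ z := h2
    rw [hρ.eq_zero hzf] at h2
    have hw := h1.mem_frontier h2
    rw [h.boundary y hy, parallelSurface_eq_tube_inter hY hy] at hw
    rw [hz, hY x hx y hy]
    exact (show Y w = y from hw.2).ge
  obtain ⟨c, hc⟩ := exists_gradient_eq_smul_of_isLocalExtrOn (hρ.contDiffAt.of_le (by simp))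
    (hYz.of_le (by simp)) hρ.gradient_ne_zero hext
  have hd := hasDerivAt_comp_line (f := Y) (hYz.differentiableAt (by simp))
  have hd' : HasDerivAt (fun s : ℝ => Y (x + s • outwardNormal Ω x)) 1 y := by
    refine (hasDerivAt_id y).congr_of_eventuallyEq ?_
    filter_upwards [isOpen_Ioo.mem_nhds hy] with s hs
    exact hY x hx s hs
  have h1 := hd.unique hd'
  have hpos := norm_pos_iff.mpr hρ.gradient_ne_zero
  have h2 : ∇ Y z = (c * ‖∇ ρ z‖) • outwardNormal Ω x := by
    rw [hc, hnu, smul_smul]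
    congr 1
    field_simp
  rw [← hz, h2, real_inner_smul_left, real_inner_self_eq_norm_sq, hnorm] at h1
  rw [h2, show c * ‖∇ ρ z‖ = 1 by linarith, one_smul]

end Foliation

end Normals

end

noncomputable section

/-! ### Integration against a measure disintegrated by a kernel. -/

section KernelDisintegration

open ProbabilityTheory

variable {α β γ : Type*} {mα : MeasurableSpace α} {mβ : MeasurableSpace β} {mγ : MeasurableSpace γ}
  {F : Type*} [NormedAddCommGroup F] [NormedSpace ℝ F]

theorem MeasureTheory.Integrable.integral_bind {μ : Measure α} {κ : Kernel α β} {f : β → F}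
    (hf : Integrable f (μ.bind κ)) : Integrable (fun x => ∫ y, f y ∂κ x) μ := by
  rw [Measure.comp_eq_comp_const_apply] at hf
  simpa using hf.integral_comp

theorem MeasureTheory.integral_bind_kernel {μ : Measure α} {κ : Kernel α β} {f : β → F}
    (hf : Integrable f (μ.bind κ)) : ∫ z, f z ∂(μ.bind κ) = ∫ x, ∫ y, f y ∂κ x ∂μ := by
  rw [Measure.comp_eq_comp_const_apply] at hf ⊢
  simpa using Kernel.integral_comp hf

/-- Adjoins time as an independent factor, so that slicing the tube also slices the space-time
cylinder over it. -/
theorem bind_prod_const {μ : Measure α} (κ : Kernel α β) [IsSFiniteKernel κ] {ν : Measure β}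
    [SFinite ν] (hν : μ.bind κ = ν) (τ : Measure γ) [SFinite τ] :
    μ.bind (κ.prod (Kernel.const α τ)) = ν.prod τ := by
  ext S hS
  rw [Measure.bind_apply hS (Kernel.aemeasurable _), Measure.prod_apply hS, ← hν,
    Measure.lintegral_bind (Kernel.aemeasurable _) (measurable_measure_prodMk_left hS).aemeasurable]
  congr with y
  rw [Kernel.prod_apply, Kernel.const_apply, Measure.prod_apply hS]

end KernelDisintegration

/-! ### Surface measures on the tube: disintegration of volume and uniform area bound. -/

section TubeMeasure

open ProbabilityTheory
open scoped NNReal ENNReal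

variable {n : ℕ} {Ω : Set (EuclideanSpace ℝ (Fin n))} {a b : ℝ}

/-- `Y` is the normal coordinate on the tube `⋃ Γ_y`, `y ∈ (a, b)`. -/
structure IsNormalCoordinate (Ω : Set (EuclideanSpace ℝ (Fin n))) (a b : ℝ)
    (Y : EuclideanSpace ℝ (Fin n) → ℝ) : Prop where
  foliation : IsTubularFoliation Ω a b
  compact : IsCompact (frontier Ω)
  smooth : ContDiffOn ℝ ∞ Y (parallelTube Ω a b)
  coord : ∀ x ∈ frontier Ω, ∀ y ∈ Ioo a b, Y (x + y • outwardNormal Ω x) = y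

theorem IsTubularFoliation.exists_isNormalCoordinate (h : IsTubularFoliation Ω a b)
    (hΩ : IsSmoothBoundedDomain Ω) : ∃ Y, IsNormalCoordinate Ω a b Y := by
  obtain ⟨Y, h1, h2⟩ := h.coordinate
  exact ⟨Y, h, hΩ.isCompact_frontier, h1, h2⟩

namespace IsNormalCoordinate

variable {Y : EuclideanSpace ℝ (Fin n) → ℝ}

theorem zero_mem (h : IsNormalCoordinate Ω a b Y) : (0 : ℝ) ∈ Ioo a b :=
  ⟨h.foliation.left_neg, h.foliation.right_pos⟩

theorem exists_eq (h : IsNormalCoordinate Ω a b Y) {z : EuclideanSpace ℝ (Fin n)}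
    (hz : z ∈ parallelTube Ω a b) : Y z ∈ Ioo a b ∧
      ∃ x ∈ frontier Ω, z = x + Y z • outwardNormal Ω x :=
  exists_eq_of_mem_parallelTube h.coord hz

theorem gradient_eq (h : IsNormalCoordinate Ω a b Y) {x : EuclideanSpace ℝ (Fin n)}
    (hx : x ∈ frontier Ω) {y : ℝ} (hy : y ∈ Ioo a b) :
    ∇ Y (x + y • outwardNormal Ω x) = outwardNormal Ω x :=
  (h.foliation.gradient_coordinate h.smooth h.coord hx hy).1

theorem norm_normal (h : IsNormalCoordinate Ω a b Y) {x : EuclideanSpace ℝ (Fin n)}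
    (hx : x ∈ frontier Ω) : ‖outwardNormal Ω x‖ = 1 :=
  (h.foliation.gradient_coordinate h.smooth h.coord hx h.zero_mem).2

theorem norm_gradient (h : IsNormalCoordinate Ω a b Y) {z : EuclideanSpace ℝ (Fin n)}
    (hz : z ∈ parallelTube Ω a b) : ‖∇ Y z‖ = 1 := by
  obtain ⟨hy, x, hx, hzx⟩ := h.exists_eq hz
  rw [hzx, h.gradient_eq hx hy, h.norm_normal hx]

theorem gradient_eq_outwardNormal (h : IsNormalCoordinate Ω a b Y) {z : EuclideanSpace ℝ (Fin n)}
    {y : ℝ} (hy : y ∈ Ioo a b) (hz : z ∈ parallelSurface Ω y) :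
    ∇ Y z = outwardNormal (parallelDomain Ω y) z := by
  obtain ⟨x, hx, rfl⟩ := hz
  rw [h.gradient_eq hx hy, h.foliation.normal x hx y hy]

theorem contDiffOn_gradient (h : IsNormalCoordinate Ω a b Y) :
    ContDiffOn ℝ ∞ (∇ Y) (parallelTube Ω a b) := by
  have h1 : ContDiffOn ℝ ∞ (fderiv ℝ Y) (parallelTube Ω a b) :=
    h.smooth.fderiv_of_isOpen h.foliation.isOpen_tube (by simp)
  exact (InnerProductSpace.toDual ℝ (EuclideanSpace ℝ (Fin n))).symm.contDiff.comp_contDiffOn h1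

theorem continuousOn_normal (h : IsNormalCoordinate Ω a b Y) :
    ContinuousOn (outwardNormal Ω) (frontier Ω) := by
  have h0 : frontier Ω ⊆ parallelTube Ω a b := by
    rw [← parallelSurface_zero]; exact parallelSurface_subset_tube h.zero_mem
  refine (h.contDiffOn_gradient.continuousOn.mono h0).congr fun x hx => ?_
  have := h.gradient_eq hx h.zero_mem
  rwa [zero_smul, add_zero, eq_comm] at this

theorem isCompact_preimage (h : IsNormalCoordinate Ω a b Y) {c d : ℝ} (hc : Icc c d ⊆ Ioo a b) :
    IsCompact (parallelTube Ω a b ∩ Y ⁻¹' Icc c d) :=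
  isCompact_parallelTube_inter_preimage h.compact h.continuousOn_normal h.coord hc

theorem isBounded_tube (h : IsNormalCoordinate Ω a b Y) :
    Bornology.IsBounded (parallelTube Ω a b) :=
  isBounded_parallelTube h.compact fun _ hx => h.norm_normal hx

theorem surfaceMeasure_eq (h : IsNormalCoordinate Ω a b Y) {y : ℝ} (hy : y ∈ Ioo a b) :
    surfaceMeasure Ω y = (μHE[n - 1] : Measure (EuclideanSpace ℝ (Fin n))).restrict
      (parallelTube Ω a b ∩ Y ⁻¹' {y}) := by
  rw [surfaceMeasure, parallelSurface_eq_tube_inter h.coord hy]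

theorem measurableSet_parallelSurface (h : IsNormalCoordinate Ω a b Y) {y : ℝ}
    (hy : y ∈ Ioo a b) : MeasurableSet (parallelSurface Ω y) := by
  have := (h.isCompact_preimage (c := y) (d := y) (by simpa using hy)).measurableSet
  rwa [Icc_self, ← parallelSurface_eq_tube_inter h.coord hy] at this

/-- The surface measures `dS_y` as a kernel, extended by zero outside `(a, b)`. -/
def kernel (h : IsNormalCoordinate Ω a b Y) : Kernel ℝ (EuclideanSpace ℝ (Fin n)) where
  toFun y := (μHE[n - 1] : Measure (EuclideanSpace ℝ (Fin n))).restrict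
      (parallelTube Ω a b ∩ Y ⁻¹' {y})
  measurable' := by
    refine Measure.measurable_of_measurable_coe _ fun A hA => ?_
    have := measurable_euclideanHausdorffMeasure_levelSet h.foliation.isOpen_tube
      (h.smooth.of_le (by simp)) (fun x hx => h.norm_gradient hx)
      (hA.inter h.foliation.isOpen_tube.measurableSet) inter_subset_right
    simp_rw [Measure.restrict_apply hA, ← inter_assoc]
    simpa using this

theorem kernel_apply (h : IsNormalCoordinate Ω a b Y) {y : ℝ} (hy : y ∈ Ioo a b) :
    h.kernel y = surfaceMeasure Ω y := (h.surfaceMeasure_eq hy).symm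

theorem kernel_apply_of_notMem (h : IsNormalCoordinate Ω a b Y) {y : ℝ} (hy : y ∉ Ioo a b) :
    h.kernel y = 0 := by
  have : parallelTube Ω a b ∩ Y ⁻¹' {y} = ∅ := by
    rw [eq_empty_iff_forall_notMem]
    rintro z ⟨hz, hzy⟩
    have hzy : Y z = y := hzy
    exact hy (hzy ▸ (h.exists_eq hz).1)
  simp [kernel, this]

/-- This is the coarea formula for `Y`, with Jacobian |∇Y| = 1: on the tube, dx = dS_y dy. -/
theorem bind_kernel (h : IsNormalCoordinate Ω a b Y) :
    (volume.restrict (Ioo a b)).bind h.kernel = volume.restrict (parallelTube Ω a b) := by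
  ext A hA
  rw [Measure.bind_apply hA (Kernel.aemeasurable _), Measure.restrict_apply hA,
    ← lintegral_euclideanHausdorffMeasure_levelSet h.foliation.isOpen_tube
      (h.smooth.of_le (by simp)) (fun x hx => h.norm_gradient hx)
      (hA.inter h.foliation.isOpen_tube.measurableSet) inter_subset_right,
    setLIntegral_eq_of_support_subset]
  · congr with y
    simp [kernel, Measure.restrict_apply hA, inter_assoc]
  · intro y hy
    by_contra hy'
    simp [h.kernel_apply_of_notMem hy'] at hy

/-- The bounded tube has finite volume, so by the coarea formula some Γ_{y₀} has finite area. Every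
Γ_y is the image of that surface under z ↦ z + (y - y₀) ∇Y(z). Only the Lipschitz constant of ∇Y on
the compact Γ_{y₀} enters, so the bound is uniform up to the ends of (a, b). -/
theorem exists_surfaceMeasure_le (h : IsNormalCoordinate Ω a b Y) :
    ∃ C : ℝ≥0, ∀ y ∈ Ioo a b, surfaceMeasure Ω y univ ≤ C := by
  obtain ⟨y₀, hy₀, hfin⟩ : ∃ y₀ ∈ Ioo a b, surfaceMeasure Ω y₀ univ < ⊤ := by
    have hfin : ∫⁻ y in Ioo a b, h.kernel y univ ≠ ⊤ := by
      rw [← Measure.bind_apply MeasurableSet.univ (Kernel.aemeasurable _), h.bind_kernel,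
        Measure.restrict_apply_univ]
      exact h.isBounded_tube.measure_lt_top.ne
    have hae := ae_lt_top (h.kernel.measurable_coe MeasurableSet.univ) hfin
    have hne : (volume.restrict (Ioo a b)) ≠ 0 := by
      rw [Ne, Measure.restrict_eq_zero, Real.volume_Ioo]
      simpa using h.zero_mem.1.trans h.zero_mem.2
    have : (ae (volume.restrict (Ioo a b))).NeBot := ae_neBot.mpr hne
    obtain ⟨y, hy1, hy2⟩ := (hae.and (ae_restrict_mem measurableSet_Ioo)).exists
    exact ⟨y, hy2, by rwa [← h.kernel_apply hy2]⟩
  have hcomp : IsCompact (parallelSurface Ω y₀) := by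
    have := h.isCompact_preimage (c := y₀) (d := y₀) (by simpa using hy₀)
    rwa [Icc_self, ← parallelSurface_eq_tube_inter h.coord hy₀] at this
  obtain ⟨K, hK⟩ : ∃ K, LipschitzOnWith K (∇ Y) (parallelSurface Ω y₀) := by
    refine LocallyLipschitzOn.exists_lipschitzOnWith_of_compact hcomp fun z hz => ?_
    obtain ⟨K, t, ht, hK⟩ := ((h.contDiffOn_gradient.contDiffAt (h.foliation.isOpen_tube.mem_nhds
      (parallelSurface_subset_tube hy₀ hz))).of_le (by simp)).exists_lipschitzOnWith
    exact ⟨K, t, mem_nhdsWithin_of_mem_nhds ht, hK⟩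
  set L : ℝ≥0 := 1 + Real.toNNReal (b - a) * K with hL
  simp only [surfaceMeasure, Measure.restrict_apply_univ] at hfin ⊢
  refine ⟨L ^ (n - 1) * ENNReal.toNNReal ((μHE[n - 1] : Measure _) (parallelSurface Ω y₀)),
    fun y hy => ?_⟩
  have hlip : LipschitzOnWith L (fun z => z + (y - y₀) • ∇ Y z) (parallelSurface Ω y₀) := by
    refine LipschitzOnWith.of_dist_le_mul fun z hz w hw => ?_
    have h1 := hK.dist_le_mul z hz w hw
    rw [dist_eq_norm] at h1
    rw [dist_eq_norm, add_sub_add_comm, ← smul_sub]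
    refine (norm_add_le _ _).trans ?_
    rw [norm_smul, hL, dist_eq_norm]
    have h2 : ‖y - y₀‖ ≤ b - a := by
      rw [Real.norm_eq_abs, abs_le]
      exact ⟨by linarith [hy.1, hy₀.2], by linarith [hy.2, hy₀.1]⟩
    have h3 : (0 : ℝ) ≤ b - a := (norm_nonneg _).trans h2
    have h4 : ‖y - y₀‖ * ‖∇ Y z - ∇ Y w‖ ≤ (b - a) * (K * ‖z - w‖) := by
      rw [dist_eq_norm] at h1
      gcongr
    push_cast
    rw [Real.coe_toNNReal _ h3]
    linarith
  have himg : (fun z => z + (y - y₀) • ∇ Y z) '' parallelSurface Ω y₀ = parallelSurface Ω y := by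
    rw [parallelSurface, parallelSurface, image_image]
    refine image_congr fun x hx => ?_
    rw [h.gradient_eq hx hy₀, add_assoc, ← add_smul]
    congr 2
    ring
  rw [← himg]
  refine (hlip.euclideanHausdorffMeasure_image_le _).trans ?_
  push_cast
  rw [ENNReal.coe_toNNReal hfin.ne]

instance isFiniteKernel (h : IsNormalCoordinate Ω a b Y) : IsFiniteKernel h.kernel := by
  obtain ⟨C, hC⟩ := h.exists_surfaceMeasure_le
  refine ⟨C, ENNReal.coe_lt_top, fun y => ?_⟩
  by_cases hy : y ∈ Ioo a b
  · rw [h.kernel_apply hy]; exact hC y hy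
  · simp [h.kernel_apply_of_notMem hy]

end IsNormalCoordinate

end TubeMeasure

end

noncomputable section

/-! ### The du Bois-Reymond lemma on an interval. -/

section DuBoisReymond

variable {F : Type*} [NormedAddCommGroup F] [NormedSpace ℝ F] [CompleteSpace F] {a b : ℝ}

theorem IsCompact.exists_Icc_of_subset_Ioo {K : Set ℝ} (hK : IsCompact K) (hab : a < b)
    (h : K ⊆ Ioo a b) : ∃ c d, c ≤ d ∧ K ⊆ Icc c d ∧ Icc c d ⊆ Ioo a b := by
  rcases K.eq_empty_or_nonempty with rfl | hne
  · exact ⟨(a + b) / 2, (a + b) / 2, le_rfl, empty_subset _, by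
      rw [Icc_self, singleton_subset_iff]; constructor <;> linarith⟩
  · obtain ⟨c, hc, hc'⟩ := hK.exists_isLeast hne
    obtain ⟨d, hd, hd'⟩ := hK.exists_isGreatest hne
    exact ⟨c, d, hc' hd, fun x hx => ⟨hc' hx, hd' hx⟩,
      fun x hx => ⟨(h hc).1.trans_le hx.1, hx.2.trans_lt (h hd).2⟩⟩

theorem contDiff_primitive {g : ℝ → ℝ} (hg : ContDiff ℝ ∞ g) (c : ℝ) :
    ContDiff ℝ ∞ (fun y => ∫ s in c..y, g s) ∧ deriv (fun y => ∫ s in c..y, g s) = g := by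
  have hd : ∀ y, HasDerivAt (fun y => ∫ s in c..y, g s) (g y) y := fun y =>
    intervalIntegral.integral_hasDerivAt_right (hg.continuous.intervalIntegrable _ _)
      (hg.continuous.stronglyMeasurableAtFilter _ _) hg.continuous.continuousAt
  have h2 : deriv (fun y => ∫ s in c..y, g s) = g := funext fun y => (hd y).deriv
  refine ⟨?_, h2⟩
  rw [contDiff_infty_iff_deriv, h2]
  exact ⟨fun y => (hd y).differentiableAt, hg⟩

/-- A test function with zero mean is the derivative of a test function. -/
theorem exists_testFunction_deriv_eq (hab : a < b) {g : ℝ → ℝ} (hg : ContDiff ℝ ∞ g)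
    (hc : HasCompactSupport g) (hs : tsupport g ⊆ Ioo a b) (h0 : ∫ y, g y = 0) :
    ∃ η : ℝ → ℝ, ContDiff ℝ ∞ η ∧ HasCompactSupport η ∧ tsupport η ⊆ Ioo a b ∧ deriv η = g := by
  obtain ⟨c, d, hcd, h1, h2⟩ := IsCompact.exists_Icc_of_subset_Ioo hc hab hs
  -- The primitive based at c vanishes to the left of the support of `g`, and to the right of it
  -- because `g` has mean zero.
  obtain ⟨h3, h4⟩ := contDiff_primitive hg c
  have hsupp : Function.support (fun y => ∫ s in c..y, g s) ⊆ Icc c d := by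
    intro y hy
    by_contra hyn
    apply hy
    rcases lt_or_ge y c with hyc | hyc
    · refine intervalIntegral.integral_zero_ae ?_ |>.trans rfl
      filter_upwards [compl_mem_ae_iff.mpr (measure_singleton c)] with s hs1 hs2
      rw [uIoc_of_ge hyc.le] at hs2
      by_contra hne
      exact hs1 (le_antisymm hs2.2 (h1 (subset_tsupport _ hne)).1)
    · have hyd : d < y := not_le.mp fun hyd => hyn ⟨hyc, hyd⟩
      simp only
      rw [intervalIntegral.integral_of_le hyc, ← integral_Icc_eq_integral_Ioc,
        setIntegral_eq_integral_of_forall_compl_eq_zero, h0]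
      intro s hs
      by_contra hne
      have := h1 (subset_tsupport _ hne)
      exact hs ⟨this.1, this.2.trans hyd.le⟩
  have hts := closure_minimal hsupp isClosed_Icc
  exact ⟨_, h3, HasCompactSupport.intro isCompact_Icc fun x hx => by
    by_contra hne; exact hx (hsupp hne), hts.trans h2, h4⟩

theorem exists_testFunction_integral_eq_one (hab : a < b) :
    ∃ g : ℝ → ℝ, ContDiff ℝ ∞ g ∧ HasCompactSupport g ∧ tsupport g ⊆ Ioo a b ∧ ∫ y, g y = 1 := by
  let f : ContDiffBump ((a + b) / 2) := ⟨(b - a) / 8, (b - a) / 4, by linarith, by linarith⟩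
  refine ⟨f.normed volume, f.contDiff_normed, f.hasCompactSupport_normed, ?_, f.integral_normed⟩
  rw [f.tsupport_normed_eq, Real.closedBall_eq_Icc]
  intro x hx
  simp only [f] at hx
  constructor <;> linarith [hx.1, hx.2]

/-- Integration by parts against a function that is merely absolutely continuous: Fubini on the
triangle s < y, where θ' integrates over (s, b) to -θ(s). -/
theorem integral_deriv_smul_primitive {r : ℝ → F} (hr : IntegrableOn r (Ioo a b)) {θ : ℝ → ℝ}
    (hθ : ContDiff ℝ ∞ θ) (hc : HasCompactSupport θ) (hs : tsupport θ ⊆ Ioo a b) :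
    ∫ y in Ioo a b, deriv θ y • ∫ s in a..y, r s = -∫ y in Ioo a b, θ y • r y := by
  have hθ' : Continuous (deriv θ) := hθ.continuous_deriv (by simp)
  have hint : Integrable (deriv θ) := hθ'.integrable_of_hasCompactSupport hc.deriv
  set μ := (volume : Measure ℝ).restrict (Ioo a b)
  have hprod : Integrable (fun q : ℝ × ℝ => {q : ℝ × ℝ | q.2 < q.1}.indicator
      (fun q => deriv θ q.1 • r q.2) q) (μ.prod μ) :=
    (hint.restrict.smul_prod hr).indicator (measurableSet_lt measurable_snd measurable_fst)
  have h1 : ∫ y in Ioo a b, deriv θ y • ∫ s in a..y, r s =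
      ∫ y, ∫ s, {q : ℝ × ℝ | q.2 < q.1}.indicator (fun q => deriv θ q.1 • r q.2) (y, s) ∂μ ∂μ := by
    refine setIntegral_congr_fun measurableSet_Ioo fun y hy => ?_
    rw [intervalIntegral.integral_of_le hy.1.le, integral_Ioc_eq_integral_Ioo, ← integral_smul,
      ← integral_indicator measurableSet_Ioo, ← integral_indicator measurableSet_Ioo]
    congr with s
    simp only [indicator, mem_Ioo, mem_ofPred_eq]
    split_ifs with h1 h2 h3 h4 h5
    · rfl
    · exact absurd h1.2 h3
    · exact absurd ⟨h1.1, h1.2.trans hy.2⟩ h2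
    · exact absurd ⟨h4.1, h5⟩ h1
    · rfl
    · rfl
  rw [h1, integral_integral_swap (by exact hprod), ← integral_neg]
  refine setIntegral_congr_fun measurableSet_Ioo fun s hs' => ?_
  have h2 : ∀ y, {q : ℝ × ℝ | q.2 < q.1}.indicator (fun q => deriv θ q.1 • r q.2) (y, s) =
      (Ioi s).indicator (fun y => deriv θ y) y • r s := fun y => by
    by_cases hy : s < y <;> simp [indicator, hy]
  simp_rw [h2]
  rw [integral_smul_const, ← neg_smul, integral_indicator measurableSet_Ioi,
    Measure.restrict_restrict measurableSet_Ioi]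
  congr 1
  have h3 : Ioi s ∩ Ioo a b = Ioo s b := by
    ext y; simp only [mem_inter_iff, mem_Ioi, mem_Ioo]
    exact ⟨fun h => ⟨h.1, h.2.2⟩, fun h => ⟨h.1, hs'.1.trans h.1, h.2⟩⟩
  rw [h3, ← integral_Ioc_eq_integral_Ioo, ← intervalIntegral.integral_of_le hs'.2.le,
    intervalIntegral.integral_deriv_eq_sub (fun x _ => hθ.differentiable (by simp) x)
      (hθ'.intervalIntegrable _ _)]
  have hb : θ b = 0 := image_eq_zero_of_notMem_tsupport fun h => (hs h).2.false
  rw [hb, zero_sub]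

/-- An integrable function with integrable weak derivative `r` is a.e. a primitive of `r`. -/
theorem ae_eq_primitive_of_weak_deriv (hab : a < b) {h r : ℝ → F} (hh : IntegrableOn h (Ioo a b))
    (hr : IntegrableOn r (Ioo a b))
    (hw : ∀ θ : ℝ → ℝ, ContDiff ℝ ∞ θ → HasCompactSupport θ → tsupport θ ⊆ Ioo a b →
      ∫ y in Ioo a b, deriv θ y • h y = -∫ y in Ioo a b, θ y • r y) :
    ∃ c : F, ∀ᵐ y ∂(volume.restrict (Ioo a b)), h y = c + ∫ s in a..y, r s := by
  obtain ⟨θ₀, h₀, hc₀, hs₀, h1⟩ := exists_testFunction_integral_eq_one hab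
  set w : ℝ → F := fun y => h y - ∫ s in a..y, r s with hwdef
  have hRc : ContinuousOn (fun y => ∫ s in a..y, r s) (Icc a b) :=
    intervalIntegral.continuousOn_primitive_interval
      (by rwa [uIcc_of_le hab.le, integrableOn_Icc_iff_integrableOn_Ioo])
      |>.mono (by rw [uIcc_of_le hab.le])
  have hRi : IntegrableOn (fun y => ∫ s in a..y, r s) (Ioo a b) :=
    (hRc.integrableOn_compact isCompact_Icc).mono_set Ioo_subset_Icc_self
  have hwi : IntegrableOn w (Ioo a b) := hh.sub hRi
  have hbd : ∀ θ : ℝ → ℝ, Continuous θ → HasCompactSupport θ → ∀ {g : ℝ → F},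
      IntegrableOn g (Ioo a b) → IntegrableOn (fun y => θ y • g y) (Ioo a b) :=
    fun θ hθ hc g hg => by
      obtain ⟨C, hC⟩ := hc.exists_bound_of_continuous hθ
      exact hg.bdd_smul C hθ.aestronglyMeasurable (ae_of_all _ hC)
  have hw0 : ∀ θ : ℝ → ℝ, ContDiff ℝ ∞ θ → HasCompactSupport θ → tsupport θ ⊆ Ioo a b →
      ∫ y in Ioo a b, deriv θ y • w y = 0 := fun θ hθ hc hs => by
    have hd := hθ.continuous_deriv (by simp)
    simp only [hwdef, smul_sub]
    rw [integral_sub (hbd _ hd hc.deriv hh) (hbd _ hd hc.deriv hRi), hw θ hθ hc hs,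
      integral_deriv_smul_primitive hr hθ hc hs, sub_self]
  -- The difference `w` has zero weak derivative, so it should equal its mean with weight θ₀. For
  -- any test function ψ, ψ - (∫ψ) θ₀ has mean zero and is a derivative η'; testing `w` with η'
  -- gives ∫ ψ (w - c) = 0.
  set c : F := ∫ y in Ioo a b, θ₀ y • w y with hcdef
  refine ⟨c, ?_⟩
  have hwc : IntegrableOn (fun y => w y - c) (Ioo a b) := hwi.sub (integrable_const c)
  have hz := isOpen_Ioo.ae_eq_zero_of_integral_contDiff_smul_eq_zero (μ := volume)
    (f := fun y => w y - c) (U := Ioo a b)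
    hwc.locallyIntegrableOn
    (fun ψ hψ hcψ hsψ => by
      have hψi : Integrable ψ := hψ.continuous.integrable_of_hasCompactSupport hcψ
      have hθi : Integrable θ₀ := h₀.continuous.integrable_of_hasCompactSupport hc₀
      obtain ⟨η, hη, hηc, hηs, hηd⟩ := exists_testFunction_deriv_eq hab
        (g := fun y => ψ y - (∫ s, ψ s) * θ₀ y) (hψ.sub (contDiff_const.mul h₀))
        (hcψ.sub hc₀.mul_left)
        ((tsupport_sub _ _).trans (union_subset hsψ ((tsupport_mul_subset_right).trans hs₀)))
        (by rw [integral_sub hψi (hθi.const_mul _), integral_const_mul, h1, mul_one, sub_self])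
      have h2 := hw0 η hη hηc hηs
      rw [hηd] at h2
      simp only [sub_smul, mul_smul] at h2
      have h4 : IntegrableOn (fun y => (∫ s, ψ s) • θ₀ y • w y) (Ioo a b) :=
        (hbd θ₀ h₀.continuous hc₀ hwi).smul (∫ s, ψ s)
      rw [integral_sub (hbd ψ hψ.continuous hcψ hwi) h4, integral_smul, ← hcdef, sub_eq_zero] at h2
      have h3 : ∫ y in Ioo a b, ψ y = ∫ y, ψ y :=
        setIntegral_eq_integral_of_forall_compl_eq_zero fun y hy =>
          image_eq_zero_of_notMem_tsupport fun h => hy (hsψ h)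
      rw [← setIntegral_eq_integral_of_forall_compl_eq_zero (s := Ioo a b) fun y hy => by
        rw [image_eq_zero_of_notMem_tsupport fun h => hy (hsψ h), zero_smul]]
      simp only [smul_sub]
      rw [integral_sub (hbd ψ hψ.continuous hcψ hwi)
        (hbd ψ hψ.continuous hcψ (integrable_const c)), h2, integral_smul_const, h3, sub_self])
  rw [ae_restrict_iff' measurableSet_Ioo]
  filter_upwards [hz] with y hy hy'
  have := hy hy'
  simp only [hwdef] at this
  rw [sub_sub, sub_eq_zero] at this
  rw [this, add_comm]

end DuBoisReymond

end

noncomputable section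

/-! ### Bounds and weighted masses at every time. -/

section MassContinuity

open Filter Metric

variable {n D : ℕ} {u : EuclideanSpace ℝ (Fin n) → ℝ → EuclideanSpace ℝ (Fin D)}

theorem setIntegral_closedBall_eq_ball {V F : Type*} [NormedAddCommGroup V]
    [InnerProductSpace ℝ V] [FiniteDimensional ℝ V] [MeasurableSpace V] [BorelSpace V]
    [NormedAddCommGroup F] [NormedSpace ℝ F] (f : V → F) (x : V) {r : ℝ} (hr : r ≠ 0) :
    ∫ y in closedBall x r, f y = ∫ y in ball x r, f y := by
  refine setIntegral_congr_set ?_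
  rw [← ball_union_sphere]
  exact union_ae_eq_left_of_ae_eq_empty (ae_eq_empty.mpr (Measure.addHaar_sphere_of_ne_zero _ x hr))

/-- The essential bound of `u` on a cylinder holds on every time slice, by continuity of the mass
on balls and Lebesgue's differentiation theorem. -/
theorem exists_bound_forall_time (hbdd : IsLocallyBounded u) (hmass : HasContinuousMass u)
    (R : ℝ) {T : ℝ} (hT : 0 < T) :
    ∃ C, 0 ≤ C ∧ ∀ t ∈ Icc 0 T, ∀ᵐ x ∂(volume.restrict (ball 0 R)), ‖u x t‖ ≤ C := by
  obtain ⟨C₀, hC₀⟩ := hbdd R T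
  set C := max C₀ 0 with hC
  have hC0 : 0 ≤ C := le_max_right _ _
  refine ⟨C, hC0, ?_⟩
  have hae : ∀ᵐ t ∂(volume.restrict (Icc (0 : ℝ) T)), ∀ᵐ x ∂(volume.restrict (closedBall 0 R)),
      ‖u x t‖ ≤ C := by
    rw [Measure.volume_eq_prod, ← Measure.prod_restrict] at hC₀
    have := Measure.measurePreserving_swap.quasiMeasurePreserving.ae hC₀
    filter_upwards [Measure.ae_ae_of_ae_prod this] with t ht
    filter_upwards [ht] with x hx
    exact hx.trans (le_max_left _ _)
  -- For a fixed ball the bound on the mass holds for a.e. t and both sides are continuous in t.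
  -- Writing it as max(·, bound) = bound lets uniqueness of continuous representatives extend it to
  -- all t, endpoints included.
  have hball : ∀ (x : EuclideanSpace ℝ (Fin n)) (r : ℝ), 0 < r → ball x r ⊆ closedBall 0 R →
      ∀ t ∈ Icc 0 T, ‖∫ z in ball x r, u z t‖ ≤ C * volume.real (ball x r) := by
    intro x r hr hsub t ht
    have hcont : ContinuousOn (fun t => ‖∫ z in ball x r, u z t‖) (Icc 0 T) :=
      ((hmass (ball x r) isOpen_ball ((convex_ball x r).isConnected ⟨x, mem_ball_self hr⟩)
        isBounded_ball).2.mono Icc_subset_Ici_self).norm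
    have := Measure.eqOn_Icc_of_ae_eq (μ := volume) hT.ne
      (f := fun t => max ‖∫ z in ball x r, u z t‖ (C * volume.real (ball x r)))
      (g := fun _ => C * volume.real (ball x r)) ?_ (ContinuousOn.sup hcont continuousOn_const)
      continuousOn_const ht
    · exact max_eq_right_iff.mp this
    · filter_upwards [hae] with s hs
      refine max_eq_right (norm_setIntegral_le_of_norm_le_const_ae measure_ball_lt_top ?_)
      exact ae_restrict_of_ae_restrict_of_subset hsub hs
  intro t ht
  rcases le_or_gt R 0 with hR | hR
  · simp [ball_eq_empty.mpr hR]
  have hint : IntegrableOn (fun x => u x t) (ball 0 R) :=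
    (hmass _ isOpen_ball ((convex_ball _ R).isConnected ⟨0, mem_ball_self hR⟩) isBounded_ball).1 t
      ht.1
  -- At a.e. x, u(x, t) is the limit of its averages over small balls, each of which is bounded by
  -- `C`.
  have hleb := IsUnifLocDoublingMeasure.ae_tendsto_average (μ := volume)
    (integrable_indicator_iff measurableSet_ball |>.mpr hint).locallyIntegrable 1
  rw [ae_restrict_iff' measurableSet_ball]
  filter_upwards [hleb] with x hx hxR
  have hδ : Tendsto (fun δ : ℝ => δ) (𝓝[>] 0) (𝓝[>] 0) := tendsto_id
  have hlim := hx (fun _ : ℝ => x) (fun δ => δ) hδ (by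
    filter_upwards [self_mem_nhdsWithin] with δ hδ
    simpa using le_of_lt hδ)
  rw [indicator_of_mem hxR] at hlim
  refine le_of_tendsto hlim.norm ?_
  have hsmall : ∀ᶠ δ : ℝ in 𝓝[>] 0, δ < R - ‖x‖ := by
    refine (eventually_lt_nhds ?_).filter_mono nhdsWithin_le_nhds
    simpa using hxR
  filter_upwards [self_mem_nhdsWithin, hsmall] with δ hδ0 hδR
  have hδ0 : 0 < δ := hδ0
  have hsub : closedBall x δ ⊆ ball 0 R := fun z hz => by
    rw [mem_closedBall, dist_eq_norm] at hz
    rw [mem_ball_zero_iff]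
    have := norm_add_le (z - x) x
    rw [sub_add_cancel] at this
    linarith
  rw [setAverage_eq, norm_smul, setIntegral_congr_fun measurableSet_closedBall
    (g := fun z => u z t) (fun z hz => indicator_of_mem (hsub hz) _),
    setIntegral_closedBall_eq_ball _ _ hδ0.ne', norm_inv, Real.norm_of_nonneg measureReal_nonneg]
  have hvol : volume.real (closedBall x δ) = volume.real (ball x δ) := by
    rw [Measure.real, Measure.real, Measure.addHaar_closedBall _ _ hδ0.le, Measure.addHaar_ball_of_pos _ _ hδ0]
  have hpos : 0 < volume.real (ball x δ) :=
    ENNReal.toReal_pos (measure_ball_pos _ _ hδ0).ne' measure_ball_lt_top.ne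
  rw [hvol, inv_mul_le_iff₀ hpos, mul_comm]
  exact hball x δ hδ0 ((ball_subset_closedBall.trans hsub).trans ball_subset_closedBall) t ht

/-- The mass hypothesis concerns connected sets, which are not stable under intersection. Convex
open sets are, and they still generate the Borel sets. -/
theorem isPiSystem_isOpen_convex {V : Type*} [NormedAddCommGroup V] [NormedSpace ℝ V] :
    IsPiSystem {A : Set V | IsOpen A ∧ Convex ℝ A} :=
  fun _ hA _ hB _ => ⟨hA.1.inter hB.1, hA.2.inter hB.2⟩

theorem borel_eq_generateFrom_isOpen_convex {V : Type*} [NormedAddCommGroup V] [NormedSpace ℝ V]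
    [SecondCountableTopology V] :
    borel V = MeasurableSpace.generateFrom {A : Set V | IsOpen A ∧ Convex ℝ A} := by
  refine (TopologicalSpace.isTopologicalBasis_of_isOpen_of_nhds (fun _ h => h.1) fun x U hx hU => ?_
    : TopologicalSpace.IsTopologicalBasis {A : Set V | IsOpen A ∧ Convex ℝ A}).borel_eq_generateFrom
  obtain ⟨ε, hε, h⟩ := Metric.isOpen_iff.mp hU x hx
  exact ⟨ball x ε, ⟨isOpen_ball, convex_ball x ε⟩, mem_ball_self hε, h⟩

/-- The mass in every measurable subset of a ball is continuous in time. -/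
theorem continuousOn_setIntegral_inter_ball (hmass : HasContinuousMass u) {R T C : ℝ}
    (hC : ∀ t ∈ Icc 0 T, ∀ᵐ x ∂(volume.restrict (ball 0 R)), ‖u x t‖ ≤ C)
    {A : Set (EuclideanSpace ℝ (Fin n))} (hA : MeasurableSet A) :
    ContinuousOn (fun t => ∫ x in A ∩ ball 0 R, u x t) (Icc 0 T) := by
  have hconv : ∀ A : Set (EuclideanSpace ℝ (Fin n)), IsOpen A → Convex ℝ A →
      (∀ t ∈ Icc 0 T, IntegrableOn (fun x => u x t) (A ∩ ball 0 R)) ∧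
      ContinuousOn (fun t => ∫ x in A ∩ ball 0 R, u x t) (Icc 0 T) := fun A hA hA' => by
    rcases (A ∩ ball 0 R).eq_empty_or_nonempty with h0 | h0
    · simp [h0, continuousOn_const]
    · obtain ⟨h1, h2⟩ := hmass (A ∩ ball 0 R) (hA.inter isOpen_ball)
        ((hA'.inter (convex_ball _ _)).isConnected h0) (isBounded_ball.subset inter_subset_right)
      exact ⟨fun t ht => h1 t ht.1, h2.mono Icc_subset_Ici_self⟩
  have hint : ∀ t ∈ Icc 0 T, IntegrableOn (fun x => u x t) (ball 0 R) := by
    simpa using (hconv univ isOpen_univ convex_univ).1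
  have hgen : (inferInstance : MeasurableSpace (EuclideanSpace ℝ (Fin n))) =
      MeasurableSpace.generateFrom
        {A : Set (EuclideanSpace ℝ (Fin n)) | IsOpen A ∧ Convex ℝ A} :=
    BorelSpace.measurable_eq.trans borel_eq_generateFrom_isOpen_convex
  induction A, hA using MeasurableSpace.induction_on_inter hgen isPiSystem_isOpen_convex with
  | empty => simp [continuousOn_const]
  | basic A hA => exact (hconv A hA.1 hA.2).2
  | compl A hA ih =>
    have hS : ContinuousOn (fun t => ∫ x in ball 0 R, u x t) (Icc 0 T) := by
      simpa using (hconv univ isOpen_univ convex_univ).2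
    refine (hS.sub ih).congr fun t ht => ?_
    have h1 := integral_inter_add_sdiff hA (hint t ht)
    rw [inter_comm, show ball (0 : EuclideanSpace ℝ (Fin n)) R \ A = Aᶜ ∩ ball 0 R by
      rw [Set.sdiff_eq, inter_comm]] at h1
    simp only [Pi.sub_apply]
    rw [← h1]
    abel
  | iUnion A hd hA ih =>
    have hm : ∀ k, MeasurableSet (A k ∩ ball 0 R) := fun k => (hA k).inter measurableSet_ball
    have hd' : Pairwise (Function.onFun Disjoint fun k => A k ∩ ball 0 R) := fun i j hij =>
      (hd hij).mono inter_subset_left inter_subset_left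
    have hfin : volume (⋃ k, A k ∩ ball (0 : EuclideanSpace ℝ (Fin n)) R) ≠ ⊤ :=
      ((measure_mono (iUnion_subset fun k => inter_subset_right)).trans_lt
        measure_ball_lt_top).ne
    -- The bound on every slice dominates the series of masses uniformly in t, so its sum is again
    -- continuous.
    have hsum : Summable fun k => C * volume.real (A k ∩ ball (0 : EuclideanSpace ℝ (Fin n)) R) := by
      refine Summable.mul_left _ (ENNReal.summable_toReal ?_)
      rwa [← measure_iUnion hd' hm]
    refine (continuousOn_tsum ih hsum fun k t ht => ?_).congr fun t ht => ?_
    · refine norm_setIntegral_le_of_norm_le_const_ae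
        ((measure_mono inter_subset_right).trans_lt measure_ball_lt_top) ?_
      exact ae_restrict_of_ae_restrict_of_subset inter_subset_right (hC t ht)
    · simp only [iUnion_inter]
      exact integral_iUnion hm hd' ((hint t ht).mono_set (iUnion_subset fun k => inter_subset_right))

/-- The mass weighted with an integrable function is continuous in time. -/
theorem continuousOn_integral_smul (hmass : HasContinuousMass u) {R T C : ℝ}
    (hC : ∀ t ∈ Icc 0 T, ∀ᵐ x ∂(volume.restrict (ball 0 R)), ‖u x t‖ ≤ C)
    {g : EuclideanSpace ℝ (Fin n) → ℝ} (hg : IntegrableOn g (ball 0 R)) :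
    ContinuousOn (fun t => ∫ x in ball 0 R, g x • u x t) (Icc 0 T) := by
  rcases le_or_gt R 0 with hR | hR
  · simp [ball_eq_empty.mpr hR, continuousOn_const]
  have hmeas : ∀ t ∈ Icc 0 T,
      AEStronglyMeasurable (fun x => u x t) (volume.restrict (ball 0 R)) := fun t ht =>
    ((hmass _ isOpen_ball ((convex_ball _ R).isConnected ⟨0, mem_ball_self hR⟩)
      isBounded_ball).1 t ht.1).aestronglyMeasurable
  have hint : ∀ t ∈ Icc 0 T, ∀ {g : EuclideanSpace ℝ (Fin n) → ℝ}, IntegrableOn g (ball 0 R) →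
      IntegrableOn (fun x => g x • u x t) (ball 0 R) := fun t ht g hg =>
    Integrable.smul_bdd hg C (hmeas t ht) (hC t ht)
  -- Indicators are the previous result; in the closure step, L¹ convergence of the weights becomes
  -- uniform convergence in t through the bound `C`.
  refine Integrable.induction (μ := volume.restrict (ball 0 R))
    (fun g : EuclideanSpace ℝ (Fin n) → ℝ =>
      ContinuousOn (fun t => ∫ x in ball 0 R, g x • u x t) (Icc 0 T)) ?_ ?_ ?_ ?_ hg
  · intro c A hA _
    refine ((continuousOn_setIntegral_inter_ball hmass hC hA).const_smul c).congr fun t ht => ?_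
    rw [Pi.smul_apply, ← integral_smul, ← Measure.restrict_restrict hA,
      ← integral_indicator hA]
    congr with x
    by_cases hx : x ∈ A <;> simp [hx]
  · intro f g _ hf hg h1 h2
    refine (h1.add h2).congr fun t ht => ?_
    simp only [Pi.add_apply, add_smul]
    exact integral_add (hint t ht hf) (hint t ht hg)
  · refine IsSeqClosed.isClosed fun f g hf hfg => ?_
    have hunif : TendstoUniformlyOn (fun k t => ∫ x in ball 0 R, f k x • u x t)
        (fun t => ∫ x in ball 0 R, g x • u x t) atTop (Icc 0 T) := by
      rw [Metric.tendstoUniformlyOn_iff]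
      intro ε hε
      have h1 : Tendsto (fun k => C * dist g (f k)) atTop (𝓝 0) := by
        have := (tendsto_iff_dist_tendsto_zero.mp hfg).const_mul C
        simpa [dist_comm] using this
      filter_upwards [h1.eventually_lt_const hε] with k hk t ht
      refine lt_of_le_of_lt ?_ hk
      rw [dist_eq_norm, ← integral_sub (hint t ht (L1.integrable_coeFn g))
        (hint t ht (L1.integrable_coeFn (f k))), L1.dist_eq_integral_dist, ← integral_const_mul]
      refine norm_integral_le_of_norm_le ?_ ?_
      · exact (((L1.integrable_coeFn g).sub (L1.integrable_coeFn (f k))).norm.congr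
          (by simp [dist_eq_norm])).const_mul C
      · filter_upwards [hC t ht] with x hx
        rw [← sub_smul, norm_smul, dist_eq_norm, mul_comm]
        gcongr
    exact hunif.continuousOn (Frequently.of_forall hf)
  · intro f g hfg _ hf
    refine hf.congr fun t ht => integral_congr_ae ?_
    filter_upwards [hfg] with x hx
    rw [hx]

end MassContinuity

end

noncomputable section

/-! ### The balance law between two exact times. -/

section WeakIdentity

open Filter Metric

variable {n D : ℕ} {f : EuclideanSpace ℝ (Fin D) → Fin D → EuclideanSpace ℝ (Fin n)}
  {u : EuclideanSpace ℝ (Fin n) → ℝ → EuclideanSpace ℝ (Fin D)}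

theorem MeasureTheory.LocallyIntegrableOn.integrable_cylinder {F : Type*} [NormedAddCommGroup F]
    {w : EuclideanSpace ℝ (Fin n) × ℝ → F}
    (hw : LocallyIntegrableOn w (univ ×ˢ Ici (0 : ℝ)) volume) (R : ℝ) {t₁ t₂ : ℝ} (ht₁ : 0 ≤ t₁) :
    Integrable w ((volume.restrict (ball 0 R)).prod (volume.restrict (Icc t₁ t₂))) := by
  rw [Measure.prod_restrict, ← Measure.volume_eq_prod]
  have : IntegrableOn w (closedBall 0 R ×ˢ Icc t₁ t₂) :=
    hw.integrableOn_compact_subset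
      (prod_mono (subset_univ _) fun t ht => ht₁.trans ht.1)
      ((isCompact_closedBall _ _).prod isCompact_Icc)
  exact this.mono_set (prod_mono ball_subset_closedBall subset_rfl)

theorem gradient_const_mul {g : EuclideanSpace ℝ (Fin n) → ℝ} (c : ℝ)
    (x : EuclideanSpace ℝ (Fin n)) (hg : DifferentiableAt ℝ g x) :
    ∇ (fun z => c * g z) x = c • ∇ g x := by
  rw [gradient, gradient, fderiv_const_mul hg, map_smul]

/-- The weak formulation, tested with `g(x) 1_{[t₁, t₂]}(t)`. -/
theorem IsWeakSolution.integral_sub_integral_eq (hu : IsWeakSolution f u)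
    (hbdd : IsLocallyBounded u) (hmass : HasContinuousMass u) {R : ℝ} (hR : 0 < R)
    {g : EuclideanSpace ℝ (Fin n) → ℝ} (hg : ContDiff ℝ ∞ g) (hgc : HasCompactSupport g)
    (hgs : tsupport g ⊆ ball 0 R) (i : Fin D) {t₁ t₂ : ℝ} (ht₁ : 0 ≤ t₁) (ht : t₁ < t₂) :
    (∫ x in ball 0 R, g x • u x t₂) i - (∫ x in ball 0 R, g x • u x t₁) i =
      ∫ q, inner ℝ (f (u q.1 q.2) i) (∇ g q.1)
        ∂((volume.restrict (ball 0 R)).prod (volume.restrict (Icc t₁ t₂))) := by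
  obtain ⟨C, hC0, hC⟩ := exists_bound_forall_time hbdd hmass R (ht₁.trans_lt ht)
  have hgi : Integrable g := hg.continuous.integrable_of_hasCompactSupport hgc
  have hMc := (continuousOn_integral_smul hmass hC hgi.integrableOn).mono
    (Icc_subset_Icc_left ht₁)
  have huint : ∀ t ∈ Icc t₁ t₂, IntegrableOn (fun x => u x t) (ball 0 R) := fun t ht =>
    (hmass _ isOpen_ball ((convex_ball _ R).isConnected ⟨0, mem_ball_self hR⟩)
      isBounded_ball).1 t (ht₁.trans ht.1)
  have hgu : ∀ t ∈ Icc t₁ t₂, IntegrableOn (fun x => g x • u x t) (ball 0 R) := fun t ht =>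
    Integrable.smul_bdd hgi.integrableOn C (huint t ht).aestronglyMeasurable
      (hC t ⟨ht₁.trans ht.1, ht.2⟩)
  set M : ℝ → ℝ := fun t => (∫ x in ball 0 R, g x • u x t) i with hMdef
  have hM : ∀ t ∈ Icc t₁ t₂, M t = ∫ x in ball 0 R, g x * u x t i := fun t ht => by
    rw [hMdef]
    have := eval_integral_piLp (fun j => (hgu t ht).eval_piLp j) i
    simpa using this
  have hMcont : ContinuousOn M (Icc t₁ t₂) :=
    (EuclideanSpace.proj (𝕜 := ℝ) i).continuous.comp_continuousOn hMc
  -- the flux through `∇ g`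
  have hgrad : Continuous (∇ g) :=
    (InnerProductSpace.toDual ℝ (EuclideanSpace ℝ (Fin n))).symm.continuous.comp
      (hg.continuous_fderiv (by simp))
  obtain ⟨C', hC'⟩ : ∃ C', ∀ x, ‖∇ g x‖ ≤ C' := by
    refine HasCompactSupport.exists_bound_of_continuous ?_ hgrad
    exact (hgc.fderiv ℝ).comp_left (map_zero _)
  set μ := (volume : Measure (EuclideanSpace ℝ (Fin n))).restrict (ball 0 R) with hμ
  set τ := (volume : Measure ℝ).restrict (Icc t₁ t₂) with hτ
  have hG : Integrable (fun q : EuclideanSpace ℝ (Fin n) × ℝ =>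
      inner ℝ (f (u q.1 q.2) i) (∇ g q.1)) (μ.prod τ) := by
    have hF := (hu.2.1 i).integrable_cylinder R (t₂ := t₂) ht₁
    refine (hF.norm.mul_const C').mono' (hF.aestronglyMeasurable.inner
      (hgrad.comp continuous_fst).aestronglyMeasurable) (ae_of_all _ fun q => ?_)
    exact (norm_inner_le_norm _ _).trans (by gcongr; exact hC' _)
  set K : ℝ → ℝ := fun t => ∫ x in ball 0 R, inner ℝ (f (u x t) i) (∇ g x) with hK
  have hKi : Integrable K τ := hG.integral_prod_right
  have hKo : IntegrableOn K (Ioo t₁ t₂) :=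
    IntegrableOn.mono_set (s := Ioo t₁ t₂) (t := Icc t₁ t₂) hKi Ioo_subset_Icc_self
  have hMo : IntegrableOn M (Ioo t₁ t₂) :=
    (hMcont.integrableOn_compact isCompact_Icc).mono_set Ioo_subset_Icc_self
  have hGae : ∀ᵐ t ∂(volume.restrict (Ioo t₁ t₂)),
      Integrable (fun x => inner ℝ (f (u x t) i) (∇ g x)) μ :=
    ae_restrict_of_ae_restrict_of_subset Ioo_subset_Icc_self hG.prod_left_ae
  -- The test function θ(t) g(x) in the i-th component alone says that the weighted mass `M` has
  -- weak derivative `K`, the flux through ∇g.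
  obtain ⟨c, hc⟩ := ae_eq_primitive_of_weak_deriv ht hMo hKo fun θ hθ hθc hθs => by
    have hweak := hu.2.2 (ball 0 R) t₁ t₂ isOpen_ball isBounded_ball ht₁ ht
      (fun j q => if j = i then θ q.2 * g q.1 else 0)
      (fun j => by
        by_cases hj : j = i
        · simp only [hj, if_true]
          exact (hθ.comp contDiff_snd).mul (hg.comp contDiff_fst)
        · simp only [hj, if_false]; exact contDiff_const)
      (fun j => by
        by_cases hj : j = i
        · simp only [hj, if_true]
          refine HasCompactSupport.intro (hgc.prod hθc) fun q hq => ?_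
          rw [mem_prod, not_and_or] at hq
          rcases hq with hq | hq
          · rw [image_eq_zero_of_notMem_tsupport hq, mul_zero]
          · rw [image_eq_zero_of_notMem_tsupport hq, zero_mul]
        · simp only [hj, if_false]; exact HasCompactSupport.zero)
      (fun j => by
        by_cases hj : j = i
        · simp only [hj, if_true]
          refine (closure_minimal ?_ ((isClosed_tsupport g).prod (isClosed_tsupport θ))).trans
            (prod_mono hgs hθs)
          intro q hq
          exact ⟨subset_tsupport _ (right_ne_zero_of_mul hq),
            subset_tsupport _ (left_ne_zero_of_mul hq)⟩
        · simp only [hj, if_false]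
          simp [tsupport])
    rw [Finset.sum_eq_single i] at hweak
    · simp only [if_true] at hweak
      rw [intervalIntegral.integral_of_le ht.le, integral_Ioc_eq_integral_Ioo] at hweak
      have hcongr : ∀ᵐ t ∂(volume.restrict (Ioo t₁ t₂)), (∫ x in ball 0 R,
          (u x t i * deriv (fun s => θ s * g x) t +
            inner ℝ (f (u x t) i) (∇ (fun z => θ t * g z) x))) =
          deriv θ t • M t + θ t • K t := by
        filter_upwards [hGae, ae_restrict_mem measurableSet_Ioo] with t hGt htI
        have htI' := Ioo_subset_Icc_self htI
        have h1 : ∀ x, u x t i * deriv (fun s => θ s * g x) t +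
            inner ℝ (f (u x t) i) (∇ (fun z => θ t * g z) x) =
            deriv θ t * (g x * u x t i) + θ t * inner ℝ (f (u x t) i) (∇ g x) := fun x => by
          rw [deriv_mul_const (hθ.differentiable (by simp) t),
            gradient_const_mul _ _ (hg.differentiable (by simp) x), inner_smul_right]
          ring
        simp_rw [h1]
        have h2 : Integrable (fun x => g x * u x t i) μ := by
          simpa using (hgu t htI').eval_piLp i
        rw [integral_add (h2.const_mul _) (hGt.const_mul _), integral_const_mul,
          integral_const_mul, hM t htI', smul_eq_mul, smul_eq_mul]
      rw [integral_congr_ae hcongr] at hweak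
      obtain ⟨B₁, hB₁⟩ := hθc.deriv.exists_bound_of_continuous (hθ.continuous_deriv (by simp))
      obtain ⟨B₂, hB₂⟩ := hθc.exists_bound_of_continuous hθ.continuous
      rw [integral_add] at hweak
      · linarith
      · exact Integrable.bdd_smul hMo B₁ (hθ.continuous_deriv (by simp)).aestronglyMeasurable
          (ae_of_all _ hB₁)
      · exact Integrable.bdd_smul hKo B₂ hθ.continuous.aestronglyMeasurable (ae_of_all _ hB₂)
    · intro j _ hj
      simp [hj]
    · simp
  have hPc : ContinuousOn (fun t => c + ∫ s in t₁..t, K s) (Icc t₁ t₂) := by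
    refine continuousOn_const.add ?_
    have := intervalIntegral.continuousOn_primitive_interval (μ := volume) (f := K)
      (a := t₁) (b := t₂) (by rw [uIcc_of_le ht.le]; exact hKi)
    rwa [uIcc_of_le ht.le] at this
  -- Both sides are continuous on the closed interval, so the a.e. identity holds at t₁ and t₂
  -- themselves, also when t₁ = 0.
  have heq := Measure.eqOn_Icc_of_ae_eq (μ := volume) ht.ne
    (by rw [← Measure.restrict_congr_set Ioo_ae_eq_Icc]; exact hc) hMcont hPc
  have e1 := heq (left_mem_Icc.mpr ht.le)
  have e2 := heq (right_mem_Icc.mpr ht.le)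
  simp only [intervalIntegral.integral_same, add_zero] at e1
  change M t₂ - M t₁ = _
  rw [e1, e2, add_sub_cancel_left, integral_prod_symm _ hG,
    intervalIntegral.integral_of_le ht.le, ← integral_Icc_eq_integral_Ioc]

end WeakIdentity

end

noncomputable section

/-! ### Weak derivative and Lipschitz continuity of the flux trace. -/

section FluxTrace

open Filter Metric ProbabilityTheory
open scoped NNReal

variable {n D : ℕ} {f : EuclideanSpace ℝ (Fin D) → Fin D → EuclideanSpace ℝ (Fin n)}
  {u : EuclideanSpace ℝ (Fin n) → ℝ → EuclideanSpace ℝ (Fin D)}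
  {Ω : Set (EuclideanSpace ℝ (Fin n))} {a b : ℝ} {Y : EuclideanSpace ℝ (Fin n) → ℝ}

namespace IsNormalCoordinate

/-- A test function of the normal coordinate, extended by zero, is a test function on the tube. -/
theorem testFunction (h : IsNormalCoordinate Ω a b Y) {θ : ℝ → ℝ} (hθ : ContDiff ℝ ∞ θ)
    (hc : HasCompactSupport θ) (hs : tsupport θ ⊆ Ioo a b) :
    ContDiff ℝ ∞ ((parallelTube Ω a b).indicator (θ ∘ Y)) ∧
    HasCompactSupport ((parallelTube Ω a b).indicator (θ ∘ Y)) ∧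
    tsupport ((parallelTube Ω a b).indicator (θ ∘ Y)) ⊆ parallelTube Ω a b := by
  obtain ⟨c, d, -, h1, h2⟩ := IsCompact.exists_Icc_of_subset_Ioo hc
    (h.zero_mem.1.trans h.zero_mem.2) hs
  have hK := h.isCompact_preimage h2
  set g := (parallelTube Ω a b).indicator (θ ∘ Y) with hg
  set K := parallelTube Ω a b ∩ Y ⁻¹' Icc c d
  have hout : ∀ x ∉ K, g x = 0 := fun x hx => by
    rw [hg, indicator_apply_eq_zero]
    intro hxt
    by_contra hne
    exact hx ⟨hxt, h1 (subset_tsupport _ hne)⟩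
  have hsupp : tsupport g ⊆ K := closure_minimal
    (fun x hx => by by_contra hxn; exact hx (hout x hxn)) hK.isClosed
  refine ⟨contDiff_iff_contDiffAt.mpr fun x => ?_, HasCompactSupport.intro hK fun x => hout x,
    hsupp.trans inter_subset_left⟩
  by_cases hx : x ∈ K
  · have hnhds := h.foliation.isOpen_tube.mem_nhds hx.1
    refine (hθ.contDiffAt.comp x (h.smooth.contDiffAt hnhds)).congr_of_eventuallyEq ?_
    filter_upwards [hnhds] with z hz
    exact indicator_of_mem hz _
  · refine (contDiffAt_const (c := (0 : ℝ))).congr_of_eventuallyEq ?_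
    filter_upwards [hK.isClosed.isOpen_compl.mem_nhds hx] with z hz
    exact hout z hz

theorem gradient_testFunction (h : IsNormalCoordinate Ω a b Y) {θ : ℝ → ℝ}
    (hθ : ContDiff ℝ ∞ θ) {x : EuclideanSpace ℝ (Fin n)} (hx : x ∈ parallelTube Ω a b) :
    ∇ ((parallelTube Ω a b).indicator (θ ∘ Y)) x = deriv θ (Y x) • ∇ Y x := by
  have hnhds := h.foliation.isOpen_tube.mem_nhds hx
  have heq : (parallelTube Ω a b).indicator (θ ∘ Y) =ᶠ[𝓝 x] θ ∘ Y := by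
    filter_upwards [hnhds] with z hz
    exact indicator_of_mem hz _
  have hY := ((h.smooth.contDiffAt hnhds).differentiableAt (by simp)).hasFDerivAt
  have hd := ((hθ.differentiable (by simp) (Y x)).hasDerivAt.comp_hasFDerivAt x hY)
  rw [gradient, gradient, heq.fderiv_eq, hd.fderiv, map_smul]

theorem exists_tube_subset_ball (h : IsNormalCoordinate Ω a b Y) :
    ∃ R, 0 < R ∧ parallelTube Ω a b ⊆ ball 0 R := by
  obtain ⟨R, hR⟩ := h.isBounded_tube.subset_ball 0
  exact ⟨max R 1, by positivity, hR.trans (ball_subset_ball (le_max_left _ _))⟩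

/-- The flux density of the foliation, as a function on the tube. -/
def _root_.tubeFlux (f : EuclideanSpace ℝ (Fin D) → Fin D → EuclideanSpace ℝ (Fin n))
    (u : EuclideanSpace ℝ (Fin n) → ℝ → EuclideanSpace ℝ (Fin D))
    (Y : EuclideanSpace ℝ (Fin n) → ℝ) (q : EuclideanSpace ℝ (Fin n) × ℝ) :
    EuclideanSpace ℝ (Fin D) :=
  WithLp.toLp 2 fun i => inner ℝ (f (u q.1 q.2) i) (∇ Y q.1)

/-- As |∇Y| = 1, the flux density is dominated by |f_i(u)|, which is integrable on bounded
cylinders. -/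
theorem integrable_tubeFlux (h : IsNormalCoordinate Ω a b Y) (hu : IsWeakSolution f u)
    {t₁ t₂ : ℝ} (ht₁ : 0 ≤ t₁) :
    Integrable (tubeFlux f u Y)
      ((volume.restrict (parallelTube Ω a b)).prod (volume.restrict (Icc t₁ t₂))) := by
  obtain ⟨R, -, hR⟩ := h.exists_tube_subset_ball
  refine integrable_piLp_iff.mpr fun i => ?_
  have hF := (hu.2.1 i).integrable_cylinder R (t₂ := t₂) ht₁
  have hF' : Integrable (fun p : EuclideanSpace ℝ (Fin n) × ℝ => f (u p.1 p.2) i)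
      ((volume.restrict (parallelTube Ω a b)).prod (volume.restrict (Icc t₁ t₂))) := by
    rw [Measure.prod_restrict] at hF ⊢
    exact IntegrableOn.mono_set (t := ball 0 R ×ˢ Icc t₁ t₂) hF (prod_mono hR subset_rfl)
  have hgm : AEStronglyMeasurable (∇ Y) (volume.restrict (parallelTube Ω a b)) :=
    h.contDiffOn_gradient.continuousOn.aestronglyMeasurable
      h.foliation.isOpen_tube.measurableSet
  refine hF'.norm.mono' (hF'.aestronglyMeasurable.inner hgm.comp_fst) ?_
  have hmem : ∀ᵐ x ∂(volume.restrict (parallelTube Ω a b)), x ∈ parallelTube Ω a b :=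
    ae_restrict_mem h.foliation.isOpen_tube.measurableSet
  filter_upwards [Measure.quasiMeasurePreserving_fst.ae hmem] with q hq
  refine (norm_inner_le_norm _ _).trans ?_
  rw [h.norm_gradient hq, mul_one]

theorem ae_mem_parallelSurface (h : IsNormalCoordinate Ω a b Y) {y : ℝ} (hy : y ∈ Ioo a b) :
    ∀ᵐ x ∂(surfaceMeasure Ω y), x ∈ parallelSurface Ω y :=
  ae_restrict_mem (h.measurableSet_parallelSurface hy)

theorem ae_fluxDensity_eq (h : IsNormalCoordinate Ω a b Y) {y : ℝ} (hy : y ∈ Ioo a b)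
    (τ : Measure ℝ) [SFinite τ] (i : Fin D) :
    (fun p : EuclideanSpace ℝ (Fin n) × ℝ => fluxDensity f u Ω y i p.1 p.2)
      =ᵐ[(h.kernel y).prod τ] fun p => tubeFlux f u Y p i := by
  rw [h.kernel_apply hy]
  have : SFinite (surfaceMeasure Ω y) := by rw [← h.kernel_apply hy]; infer_instance
  filter_upwards [Measure.quasiMeasurePreserving_fst.ae (h.ae_mem_parallelSurface hy)] with q hq
  rw [fluxDensity, tubeFlux, h.gradient_eq_outwardNormal hy hq]

theorem ae_integrable_tubeFlux (h : IsNormalCoordinate Ω a b Y) (hu : IsWeakSolution f u)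
    {t₁ t₂ : ℝ} (ht₁ : 0 ≤ t₁) :
    ∀ᵐ y ∂(volume.restrict (Ioo a b)), Integrable (tubeFlux f u Y)
      ((h.kernel y).prod (volume.restrict (Icc t₁ t₂))) := by
  have h1 := h.integrable_tubeFlux hu (t₂ := t₂) ht₁
  rw [← bind_prod_const h.kernel h.bind_kernel] at h1
  simpa [Kernel.prod_apply] using Measure.ae_integrable_of_integrable_comp h1

theorem ae_fluxTrace_eq (h : IsNormalCoordinate Ω a b Y) (hu : IsWeakSolution f u)
    {t₁ t₂ : ℝ} (ht₁ : 0 ≤ t₁) (ht : t₁ < t₂) :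
    ∀ᵐ y ∂(volume.restrict (Ioo a b)), fluxTrace f u Ω t₁ t₂ y =
      ∫ q, tubeFlux f u Y q ∂((h.kernel y).prod (volume.restrict (Icc t₁ t₂))) := by
  filter_upwards [h.ae_integrable_tubeFlux hu (t₂ := t₂) ht₁, ae_restrict_mem measurableSet_Ioo]
    with y hi hy
  ext i
  have h1 := eval_integral_piLp (fun j => hi.eval_piLp j) i
  rw [h1, fluxTrace, ← integral_congr_ae (h.ae_fluxDensity_eq hy _ i),
    integral_prod_symm _ ((hi.eval_piLp i).congr (h.ae_fluxDensity_eq hy _ i).symm)]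
  simp only
  rw [intervalIntegral.integral_of_le ht.le, ← integral_Icc_eq_integral_Ioc, h.kernel_apply hy]

/-- The (negative) weak derivative of the flux trace: the surface mass defect. -/
def surfaceMassDefect (h : IsNormalCoordinate Ω a b Y)
    (u : EuclideanSpace ℝ (Fin n) → ℝ → EuclideanSpace ℝ (Fin D)) (t₁ t₂ y : ℝ) :
    EuclideanSpace ℝ (Fin D) :=
  ∫ x, (u x t₁ - u x t₂) ∂(h.kernel y)

theorem integrableOn_slice (hmass : HasContinuousMass u) {R : ℝ} (hR : 0 < R) {t : ℝ}
    (ht : 0 ≤ t) : IntegrableOn (fun x => u x t) (ball 0 R) :=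
  (hmass _ isOpen_ball ((convex_ball _ R).isConnected ⟨0, mem_ball_self hR⟩) isBounded_ball).1 t ht

theorem integrableOn_sub_tube (h : IsNormalCoordinate Ω a b Y) (hmass : HasContinuousMass u)
    {t₁ t₂ : ℝ} (ht₁ : 0 ≤ t₁) (ht₂ : 0 ≤ t₂) :
    IntegrableOn (fun x => u x t₁ - u x t₂) (parallelTube Ω a b) := by
  obtain ⟨R, hR, hsub⟩ := h.exists_tube_subset_ball
  exact ((integrableOn_slice hmass hR ht₁).sub (integrableOn_slice hmass hR ht₂)).mono_set hsub

theorem integrableOn_surfaceMassDefect (h : IsNormalCoordinate Ω a b Y)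
    (hmass : HasContinuousMass u) {t₁ t₂ : ℝ} (ht₁ : 0 ≤ t₁) (ht₂ : 0 ≤ t₂) :
    IntegrableOn (h.surfaceMassDefect u t₁ t₂) (Ioo a b) := by
  have h1 : Integrable _ (volume.restrict (parallelTube Ω a b)) :=
    h.integrableOn_sub_tube hmass ht₁ ht₂
  rw [← h.bind_kernel] at h1
  exact h1.integral_bind

/-- The integrand is at most 2C a.e. on the tube, hence dS_y-a.e. for a.e. y, and the areas of the
Γ_y are uniformly bounded. -/
theorem exists_norm_surfaceMassDefect_le (h : IsNormalCoordinate Ω a b Y)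
    (hbdd : IsLocallyBounded u) (hmass : HasContinuousMass u) {t₁ t₂ : ℝ} (ht₁ : 0 ≤ t₁)
    (ht : t₁ < t₂) :
    ∃ L : ℝ≥0, ∀ᵐ y ∂(volume.restrict (Ioo a b)), ‖h.surfaceMassDefect u t₁ t₂ y‖ ≤ L := by
  obtain ⟨R, -, hsub⟩ := h.exists_tube_subset_ball
  obtain ⟨C, hC0, hC⟩ := exists_bound_forall_time hbdd hmass R (ht₁.trans_lt ht)
  obtain ⟨S, hS⟩ := h.exists_surfaceMeasure_le
  have hae : ∀ᵐ x ∂((volume.restrict (Ioo a b)).bind h.kernel), ‖u x t₁ - u x t₂‖ ≤ 2 * C := by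
    rw [h.bind_kernel]
    filter_upwards [ae_restrict_of_ae_restrict_of_subset hsub (hC t₁ ⟨ht₁, ht.le⟩),
      ae_restrict_of_ae_restrict_of_subset hsub (hC t₂ ⟨ht₁.trans ht.le, le_rfl⟩)] with x h1 h2
    exact (norm_sub_le _ _).trans (by linarith)
  refine ⟨⟨2 * C * S, by positivity⟩, ?_⟩
  filter_upwards [Measure.ae_ae_of_ae_comp hae, ae_restrict_mem measurableSet_Ioo] with y hy hyI
  refine (norm_integral_le_of_norm_le_const hy).trans ?_
  change 2 * C * _ ≤ 2 * C * (S : ℝ)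
  gcongr
  rw [Measure.real, h.kernel_apply hyI]
  exact ENNReal.toReal_le_coe_of_le_coe (hS y hyI)

theorem integral_smul_kernel (h : IsNormalCoordinate Ω a b Y) (θ : ℝ → ℝ) {F : Type*}
    [NormedAddCommGroup F] [NormedSpace ℝ F] (τ : Measure ℝ) [SFinite τ]
    (G : EuclideanSpace ℝ (Fin n) × ℝ → F) {y : ℝ} (hy : y ∈ Ioo a b) :
    θ y • ∫ q, G q ∂((h.kernel y).prod τ) = ∫ q, θ (Y q.1) • G q ∂((h.kernel y).prod τ) := by
  rw [← integral_smul]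
  refine integral_congr_ae ?_
  have hae : ∀ᵐ x ∂(h.kernel y), x ∈ parallelSurface Ω y := by
    rw [h.kernel_apply hy]; exact h.ae_mem_parallelSurface hy
  filter_upwards [Measure.quasiMeasurePreserving_fst.ae hae] with q hq
  rw [parallelSurface_eq_tube_inter h.coord hy] at hq
  rw [show Y q.1 = y from hq.2]

theorem integrable_comp_coordinate_smul (h : IsNormalCoordinate Ω a b Y) {θ : ℝ → ℝ}
    (hθ : Continuous θ) (hc : HasCompactSupport θ) {β F : Type*} [MeasurableSpace β]
    [NormedAddCommGroup F] [NormedSpace ℝ F] {μ : Measure β} {p : β → EuclideanSpace ℝ (Fin n)}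
    (hp : Measure.QuasiMeasurePreserving p μ (volume.restrict (parallelTube Ω a b)))
    {G : β → F} (hG : Integrable G μ) : Integrable (fun q => θ (Y (p q)) • G q) μ := by
  obtain ⟨C, hC⟩ := hc.exists_bound_of_continuous hθ
  have hY : AEStronglyMeasurable (fun x => θ (Y x)) (volume.restrict (parallelTube Ω a b)) :=
    (hθ.comp_continuousOn h.smooth.continuousOn).aestronglyMeasurable
      h.foliation.isOpen_tube.measurableSet
  exact hG.bdd_smul C (hY.comp_quasiMeasurePreserving hp) (ae_of_all _ fun q => hC _)

/-- The heart of the argument: the balance law for the weight g = θ ∘ Y. Since ∇g = θ'(Y) ∇Y,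
slicing its flux side by `Y` produces ∫ θ' h; on the mass side g is constant on each Γ_y, so slicing
produces θ times the surface mass defect. -/
theorem integral_deriv_smul_fluxTrace (h : IsNormalCoordinate Ω a b Y) (hu : IsWeakSolution f u)
    (hbdd : IsLocallyBounded u) (hmass : HasContinuousMass u) {t₁ t₂ : ℝ} (ht₁ : 0 ≤ t₁)
    (ht : t₁ < t₂) {θ : ℝ → ℝ} (hθ : ContDiff ℝ ∞ θ) (hc : HasCompactSupport θ)
    (hs : tsupport θ ⊆ Ioo a b) :
    ∫ y in Ioo a b, deriv θ y • fluxTrace f u Ω t₁ t₂ y =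
      -∫ y in Ioo a b, θ y • h.surfaceMassDefect u t₁ t₂ y := by
  obtain ⟨R, hR, hsub⟩ := h.exists_tube_subset_ball
  obtain ⟨hg, hgc, hgs⟩ := h.testFunction hθ hc hs
  set g := (parallelTube Ω a b).indicator (θ ∘ Y) with hgdef
  set τ := (volume : Measure ℝ).restrict (Icc t₁ t₂) with hτ
  have ht₂ : 0 ≤ t₂ := ht₁.trans ht.le
  have hθ' := hθ.continuous_deriv (by simp)
  -- the flux side
  have hflux : Integrable (fun q => deriv θ (Y q.1) • tubeFlux f u Y q)
      ((volume.restrict (parallelTube Ω a b)).prod τ) :=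
    h.integrable_comp_coordinate_smul hθ' hc.deriv Measure.quasiMeasurePreserving_fst
      (h.integrable_tubeFlux hu ht₁)
  have hL : ∫ y in Ioo a b, deriv θ y • fluxTrace f u Ω t₁ t₂ y =
      ∫ q, deriv θ (Y q.1) • tubeFlux f u Y q
        ∂((volume.restrict (parallelTube Ω a b)).prod τ) := by
    rw [← bind_prod_const h.kernel h.bind_kernel] at hflux ⊢
    rw [integral_bind_kernel hflux]
    refine integral_congr_ae ?_
    filter_upwards [h.ae_fluxTrace_eq hu ht₁ ht, ae_restrict_mem measurableSet_Ioo] with y h1 hy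
    rw [h1, h.integral_smul_kernel _ _ _ hy, Kernel.prod_apply, Kernel.const_apply]
  -- the mass side
  have hmi : Integrable (fun x => θ (Y x) • (u x t₁ - u x t₂))
      (volume.restrict (parallelTube Ω a b)) :=
    h.integrable_comp_coordinate_smul (p := id) hθ.continuous hc
      (Measure.QuasiMeasurePreserving.id _) (h.integrableOn_sub_tube hmass ht₁ ht₂)
  have hRr : ∫ y in Ioo a b, θ y • h.surfaceMassDefect u t₁ t₂ y =
      ∫ x in parallelTube Ω a b, θ (Y x) • (u x t₁ - u x t₂) := by
    rw [← h.bind_kernel] at hmi ⊢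
    rw [integral_bind_kernel hmi]
    refine integral_congr_ae ?_
    filter_upwards [ae_restrict_mem measurableSet_Ioo] with y hy
    rw [surfaceMassDefect, ← integral_smul]
    refine integral_congr_ae ?_
    have hae : ∀ᵐ x ∂(h.kernel y), x ∈ parallelSurface Ω y := by
      rw [h.kernel_apply hy]; exact h.ae_mem_parallelSurface hy
    filter_upwards [hae] with x hx
    rw [parallelSurface_eq_tube_inter h.coord hy] at hx
    rw [show Y x = y from hx.2]
  obtain ⟨C, hC0, hC⟩ := exists_bound_forall_time hbdd hmass R (ht₁.trans_lt ht)
  have hgi : Integrable g := hg.continuous.integrable_of_hasCompactSupport hgc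
  have hgu : ∀ t ∈ Icc t₁ t₂, IntegrableOn (fun x => g x • u x t) (ball 0 R) := fun t ht' =>
    Integrable.smul_bdd hgi.integrableOn C
      (integrableOn_slice hmass hR (ht₁.trans ht'.1)).aestronglyMeasurable
      (hC t ⟨ht₁.trans ht'.1, ht'.2⟩)
  have hRr' : ∫ x in parallelTube Ω a b, θ (Y x) • (u x t₁ - u x t₂) =
      (∫ x in ball 0 R, g x • u x t₁) - ∫ x in ball 0 R, g x • u x t₂ := by
    rw [← integral_sub (hgu t₁ ⟨le_rfl, ht.le⟩) (hgu t₂ ⟨ht.le, le_rfl⟩),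
      setIntegral_eq_of_subset_of_forall_sdiff_eq_zero measurableSet_ball hsub
        (f := fun x => g x • u x t₁ - g x • u x t₂)]
    · refine setIntegral_congr_fun h.foliation.isOpen_tube.measurableSet fun x hx => ?_
      simp only [hgdef, indicator_of_mem hx, Function.comp_apply, smul_sub]
    · rintro x ⟨-, hx⟩
      simp [hgdef, indicator_of_notMem hx]
  rw [hL, hRr, hRr', neg_sub]
  ext i
  rw [PiLp.sub_apply, hu.integral_sub_integral_eq hbdd hmass hR hg hgc (hgs.trans hsub) i ht₁ ht,
    eval_integral_piLp (fun j => hflux.eval_piLp j) i, Measure.prod_restrict, Measure.prod_restrict]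
  rw [setIntegral_eq_of_subset_of_forall_sdiff_eq_zero
    (measurableSet_ball.prod measurableSet_Icc) (prod_mono hsub (subset_refl (Icc t₁ t₂)))
    (f := fun q : EuclideanSpace ℝ (Fin n) × ℝ => inner ℝ (f (u q.1 q.2) i) (∇ g q.1))]
  · refine setIntegral_congr_fun
      (h.foliation.isOpen_tube.measurableSet.prod measurableSet_Icc) fun q hq => ?_
    simp only [tubeFlux, PiLp.smul_apply, smul_eq_mul]
    rw [hgdef, h.gradient_testFunction hθ hq.1, inner_smul_right]
  · rintro q ⟨hq1, hq2⟩
    have hq : q.1 ∉ parallelTube Ω a b := fun hq => hq2 ⟨hq, hq1.2⟩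
    have hz : fderiv ℝ g q.1 = 0 := by
      have := image_eq_zero_of_notMem_tsupport (f := fderiv ℝ g) (x := q.1)
        fun hq' => hq (hgs (tsupport_fderiv_subset ℝ hq'))
      exact this
    simp [gradient, hz]

end IsNormalCoordinate

/-- The flux trace of a foliation is Lipschitz continuous, with bounded weak derivative. -/
theorem IsTubularFoliation.fluxTrace_lipschitz (hfol : IsTubularFoliation Ω a b)
    (hΩ : IsSmoothBoundedDomain Ω) (hu : IsWeakSolution f u)
    (hbdd : IsLocallyBounded u) (hmass : HasContinuousMass u) {t₁ t₂ : ℝ} (ht₁ : 0 ≤ t₁)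
    (ht : t₁ < t₂) :
    (∀ᵐ y ∂(volume.restrict (Ioo a b)), ∀ i : Fin D,
        Integrable
          (fun p : EuclideanSpace ℝ (Fin n) × ℝ => fluxDensity f u Ω y i p.1 p.2)
          ((surfaceMeasure Ω y).prod (volume.restrict (Icc t₁ t₂)))) ∧
      (∃ (H : ℝ → EuclideanSpace ℝ (Fin D)) (L : NNReal), LipschitzOnWith L H (Ioo a b) ∧
        ∀ᵐ y ∂(volume.restrict (Ioo a b)), fluxTrace f u Ω t₁ t₂ y = H y) ∧
      (∃ r : ℝ → EuclideanSpace ℝ (Fin D), MemLp r ⊤ (volume.restrict (Ioo a b)) ∧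
        ∀ θ : ℝ → ℝ, ContDiff ℝ ∞ θ → HasCompactSupport θ → tsupport θ ⊆ Ioo a b →
          ∫ y in Ioo a b, deriv θ y • fluxTrace f u Ω t₁ t₂ y = -∫ y in Ioo a b, θ y • r y) := by
  obtain ⟨Y, h⟩ := hfol.exists_isNormalCoordinate hΩ
  obtain ⟨L, hL⟩ := h.exists_norm_surfaceMassDefect_le hbdd hmass ht₁ ht
  have hri := h.integrableOn_surfaceMassDefect hmass (t₂ := t₂) ht₁ (ht₁.trans ht.le)
  have hab : a < b := h.zero_mem.1.trans h.zero_mem.2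
  have hweak : ∀ θ : ℝ → ℝ, ContDiff ℝ ∞ θ → HasCompactSupport θ → tsupport θ ⊆ Ioo a b → _ :=
    fun θ hθ hc hs => h.integral_deriv_smul_fluxTrace hu hbdd hmass ht₁ ht hθ hc hs
  refine ⟨?_, ?_, h.surfaceMassDefect u t₁ t₂,
    memLp_top_of_bound hri.aestronglyMeasurable L hL, hweak⟩
  · filter_upwards [h.ae_integrable_tubeFlux hu (t₂ := t₂) ht₁, ae_restrict_mem measurableSet_Ioo]
      with y hi hy i
    rw [← h.kernel_apply hy]
    exact (hi.eval_piLp i).congr (h.ae_fluxDensity_eq hy _ i).symm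
  · have htr : IntegrableOn (fluxTrace f u Ω t₁ t₂) (Ioo a b) := by
      have h1 := h.integrable_tubeFlux hu (t₂ := t₂) ht₁
      rw [← bind_prod_const h.kernel h.bind_kernel] at h1
      refine h1.integral_bind.congr ?_
      filter_upwards [h.ae_fluxTrace_eq hu ht₁ ht] with y hy
      rw [hy, Kernel.prod_apply, Kernel.const_apply]
    obtain ⟨c, hc⟩ := ae_eq_primitive_of_weak_deriv hab htr hri hweak
    -- The Lipschitz representative is a primitive of the defect, and its constant is the essential
    -- bound of the defect.
    refine ⟨_, L, ?_, hc⟩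
    have hii : ∀ y ∈ Ioo a b,
        IntervalIntegrable (h.surfaceMassDefect u t₁ t₂) volume a y := fun y hy => by
      rw [intervalIntegrable_iff_integrableOn_Ioo_of_le hy.1.le]
      exact hri.mono_set (Ioo_subset_Ioo_right hy.2.le)
    refine LipschitzOnWith.of_dist_le_mul fun y hy z hz => ?_
    rw [dist_eq_norm, add_sub_add_left_eq_sub,
      intervalIntegral.integral_interval_sub_left (hii y hy) (hii z hz), dist_eq_norm,
      Real.norm_eq_abs]
    refine intervalIntegral.norm_integral_le_of_norm_le_const_ae ?_
    filter_upwards [(ae_restrict_iff' measurableSet_Ioo).mp hL] with s hs1 hs2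
    refine hs1 ?_
    rw [uIoc, mem_Ioc] at hs2
    exact ⟨(lt_min hz.1 hy.1).trans hs2.1, hs2.2.trans_lt (max_lt hz.2 hy.2)⟩

end FluxTrace

end

noncomputable section

/-! ### Normal coordinates near a boundary point. -/

section LocalNormalCoordinates

open Filter Metric

variable {n : ℕ} {Ω : Set (EuclideanSpace ℝ (Fin n))} {p : EuclideanSpace ℝ (Fin n)}
  {ρ : EuclideanSpace ℝ (Fin n) → ℝ}

theorem ContDiffAt.gradient_infty (hρ : ContDiffAt ℝ ∞ ρ p) : ContDiffAt ℝ ∞ (∇ ρ) p :=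
  (InnerProductSpace.toDual ℝ (EuclideanSpace ℝ (Fin n))).symm.contDiff.contDiffAt.comp p
    (hρ.fderiv_right (by simp))

/-- The unit vector field `∇ρ / |∇ρ|`. -/
def normalField (ρ : EuclideanSpace ℝ (Fin n) → ℝ) (x : EuclideanSpace ℝ (Fin n)) :
    EuclideanSpace ℝ (Fin n) := ‖∇ ρ x‖⁻¹ • ∇ ρ x

namespace IsLocalDefiningFunction

theorem contDiffAt_normalField (h : IsLocalDefiningFunction Ω p ρ) :
    ContDiffAt ℝ ∞ (normalField ρ) p := by
  have h1 := h.contDiffAt.gradient_infty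
  exact ((h1.norm ℝ h.gradient_ne_zero).inv (norm_ne_zero_iff.mpr h.gradient_ne_zero)).smul h1

theorem norm_normalField (h : IsLocalDefiningFunction Ω p ρ) : ‖normalField ρ p‖ = 1 := by
  rw [normalField, norm_smul, norm_inv, norm_norm,
    inv_mul_cancel₀ (norm_ne_zero_iff.mpr h.gradient_ne_zero)]

theorem inner_gradient_normalField (h : IsLocalDefiningFunction Ω p ρ) :
    inner ℝ (∇ ρ p) (normalField ρ p) = ‖∇ ρ p‖ := by
  have := norm_ne_zero_iff.mpr h.gradient_ne_zero
  rw [normalField, inner_smul_right, real_inner_self_eq_norm_sq]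
  field_simp

/-- Differentiate |N|² = 1, which holds in a whole neighbourhood of p. -/
theorem inner_normalField_fderiv (h : IsLocalDefiningFunction Ω p ρ)
    (w : EuclideanSpace ℝ (Fin n)) :
    inner ℝ (normalField ρ p) (fderiv ℝ (normalField ρ) p w) = 0 := by
  have hd := (h.contDiffAt_normalField.differentiableAt (by simp)).hasFDerivAt
  have h1 := hd.inner ℝ hd
  have h2 : HasFDerivAt (fun x => inner ℝ (normalField ρ x) (normalField ρ x))
      (0 : EuclideanSpace ℝ (Fin n) →L[ℝ] ℝ) p := by
    refine (hasFDerivAt_const (1 : ℝ) p).congr_of_eventuallyEq ?_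
    filter_upwards [h.eventually] with x hx
    rw [real_inner_self_eq_norm_sq, hx.norm_normalField, one_pow]
  have h3 := DFunLike.congr_fun (h1.unique h2) w
  simp only [fderivInnerCLM_apply, ContinuousLinearMap.comp_apply, ContinuousLinearMap.prod_apply,
    zero_apply, real_inner_comm (normalField ρ p)] at h3
  rw [real_inner_comm] at h3 ⊢
  linarith

theorem outwardNormal_eq_normalField (h : IsLocalDefiningFunction Ω p ρ) (hp : p ∈ frontier Ω) :
    outwardNormal Ω p = normalField ρ p := h.outwardNormal_eq hp

/-- The map `(x, y) ↦ (x + y N(x), ρ(x))`. -/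
def _root_.normalMap (ρ : EuclideanSpace ℝ (Fin n) → ℝ) (q : EuclideanSpace ℝ (Fin n) × ℝ) :
    EuclideanSpace ℝ (Fin n) × ℝ := (q.1 + q.2 • normalField ρ q.1, ρ q.1)

theorem contDiffAt_normalMap (h : IsLocalDefiningFunction Ω p ρ) (y : ℝ) :
    ContDiffAt ℝ ∞ (normalMap ρ) (p, y) := by
  have h1 : ContDiffAt ℝ ∞ (fun q : EuclideanSpace ℝ (Fin n) × ℝ => normalField ρ q.1) (p, y) :=
    ContDiffAt.comp (g := normalField ρ) (p, y) h.contDiffAt_normalField contDiffAt_fst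
  have h2 : ContDiffAt ℝ ∞ (fun q : EuclideanSpace ℝ (Fin n) × ℝ => ρ q.1) (p, y) :=
    h.contDiffAt.comp (p, y) contDiffAt_fst
  exact (contDiffAt_fst.add (contDiffAt_snd.smul h1)).prodMk h2

/-- The extra component ρ lets the inverse function theorem act on ℝⁿ × ℝ without charts on ∂Ω,
which is the slice ρ = 0. The derivative at y = 0 is (w, s) ↦ (w + s N, ⟨∇ρ, w⟩); on its kernel w =
-s N, so s |∇ρ| = 0. -/
theorem exists_equiv_fderiv_normalMap (h : IsLocalDefiningFunction Ω p ρ) :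
    ∃ e : (EuclideanSpace ℝ (Fin n) × ℝ) ≃L[ℝ] (EuclideanSpace ℝ (Fin n) × ℝ),
      (e : (EuclideanSpace ℝ (Fin n) × ℝ) →L[ℝ] (EuclideanSpace ℝ (Fin n) × ℝ)) =
        fderiv ℝ (normalMap ρ) (p, 0) := by
  have hN := (h.contDiffAt_normalField.differentiableAt (by simp)).hasFDerivAt
  have hρ := (h.contDiffAt.differentiableAt (by simp)).hasFDerivAt
  have hf : HasFDerivAt (Prod.fst : EuclideanSpace ℝ (Fin n) × ℝ → _)
    (ContinuousLinearMap.fst ℝ (EuclideanSpace ℝ (Fin n)) ℝ) (p, 0) := hasFDerivAt_fst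
  have hs : HasFDerivAt (Prod.snd : EuclideanSpace ℝ (Fin n) × ℝ → _)
    (ContinuousLinearMap.snd ℝ (EuclideanSpace ℝ (Fin n)) ℝ) (p, 0) := hasFDerivAt_snd
  have hd : HasFDerivAt (normalMap ρ) _ (p, 0) :=
    (hf.add (hs.smul (hN.comp (p, (0 : ℝ)) hf))).prodMk (hρ.comp (p, (0 : ℝ)) hf)
  have hinj : Function.Injective (fderiv ℝ (normalMap ρ) (p, 0)).toLinearMap := by
    rw [← LinearMap.ker_eq_bot, LinearMap.ker_eq_bot', hd.fderiv]
    rintro ⟨w, s⟩ hw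
    have h1 := congrArg Prod.fst hw
    have h2 := congrArg Prod.snd hw
    simp at h1 h2
    have h3 : w = -(s • normalField ρ p) := eq_neg_of_add_eq_zero_left h1
    rw [← inner_gradient_eq_fderiv, h3, inner_neg_right, inner_smul_right,
      h.inner_gradient_normalField, neg_eq_zero, mul_eq_zero] at h2
    have hs0 : s = 0 := h2.resolve_right (norm_ne_zero_iff.mpr h.gradient_ne_zero)
    rw [hs0, zero_smul, neg_zero] at h3
    rw [h3, hs0]
    rfl
  refine ⟨(LinearEquiv.ofInjectiveEndo _ hinj).toContinuousLinearEquiv, ?_⟩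
  ext q <;> rfl

/-- Along a short normal segment the derivative of ρ stays close to |∇ρ(p)| > 0, so ρ increases
strictly through its value 0 at the boundary. -/
theorem eventually_mem_iff_neg (h : IsLocalDefiningFunction Ω p ρ) :
    ∀ᶠ q : EuclideanSpace ℝ (Fin n) × ℝ in 𝓝 (p, 0), q.1 ∈ frontier Ω →
      (q.1 + q.2 • normalField ρ q.1 ∈ Ω ↔ q.2 < 0) := by
  have hmap : ContinuousAt (fun q : EuclideanSpace ℝ (Fin n) × ℝ =>
      q.1 + q.2 • normalField ρ q.1) (p, 0) :=
    (continuous_fst.continuousAt.comp (h.contDiffAt_normalMap 0).continuousAt)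
  have hmap' : Tendsto (fun q : EuclideanSpace ℝ (Fin n) × ℝ =>
      q.1 + q.2 • normalField ρ q.1) (𝓝 (p, 0)) (𝓝 p) := by
    simpa [ContinuousAt] using hmap
  have hfst : Tendsto (fun q : EuclideanSpace ℝ (Fin n) × ℝ => q.1) (𝓝 (p, 0)) (𝓝 p) :=
    continuous_fst.tendsto (p, (0 : ℝ))
  have hpos : ∀ᶠ q : EuclideanSpace ℝ (Fin n) × ℝ in 𝓝 (p, 0),
      0 < inner ℝ (∇ ρ (q.1 + q.2 • normalField ρ q.1)) (normalField ρ q.1) := by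
    have h1 : Tendsto (fun q : EuclideanSpace ℝ (Fin n) × ℝ =>
        inner ℝ (∇ ρ (q.1 + q.2 • normalField ρ q.1)) (normalField ρ q.1)) (𝓝 (p, 0))
        (𝓝 (inner ℝ (∇ ρ p) (normalField ρ p))) :=
      (h.contDiffAt.gradient_infty.continuousAt.tendsto.comp hmap').inner
        (h.contDiffAt_normalField.continuousAt.tendsto.comp hfst)
    refine h1.eventually_const_lt ?_
    rw [h.inner_gradient_normalField]
    exact norm_pos_iff.mpr h.gradient_ne_zero
  obtain ⟨r, hr, hball⟩ := Metric.eventually_nhds_iff_ball.mp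
    (hpos.and ((hmap'.eventually h.eventually).and (hfst.eventually h.eventually)))
  filter_upwards [ball_mem_nhds _ hr] with q hq hqf
  obtain ⟨x, y⟩ := q
  rw [← ball_prod_same, mem_prod] at hq
  obtain ⟨hx, hy⟩ := hq
  simp only at hx hy hqf ⊢
  rw [Real.ball_eq_Ioo, zero_sub, zero_add] at hy
  have hb : ∀ t ∈ Ioo (-r) r, ((x, t) : EuclideanSpace ℝ (Fin n) × ℝ) ∈ ball (p, (0 : ℝ)) r :=
    fun t ht => by
      rw [← ball_prod_same, mem_prod, Real.ball_eq_Ioo, zero_sub, zero_add]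
      exact ⟨hx, ht⟩
  have hder : ∀ t ∈ Ioo (-r) r, HasDerivAt (fun s : ℝ => ρ (x + s • normalField ρ x))
      (inner ℝ (∇ ρ (x + t • normalField ρ x)) (normalField ρ x)) t := fun t ht =>
    hasDerivAt_comp_line ((hball _ (hb t ht)).2.1.contDiffAt.differentiableAt (by simp))
  have hmono : StrictMonoOn (fun s : ℝ => ρ (x + s • normalField ρ x)) (Ioo (-r) r) := by
    refine strictMonoOn_of_deriv_pos (convex_Ioo _ _)
      (fun t ht => (hder t ht).continuousAt.continuousWithinAt) fun t ht => ?_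
    rw [interior_Ioo] at ht
    rw [(hder t ht).deriv]
    exact (hball _ (hb t ht)).1
  have h0 : (0 : ℝ) ∈ Ioo (-r) r := ⟨by linarith, hr⟩
  have hx0 : ρ x = 0 := (hball _ (hb 0 h0)).2.2.eq_zero hqf
  rw [(hball _ (hb y hy)).2.1.eventually_mem_iff.self_of_nhds]
  have h2 := hmono.lt_iff_lt hy h0
  simp only [zero_smul, add_zero, hx0] at h2
  exact h2

end IsLocalDefiningFunction

/-- `P` is a smooth inverse near `x + y ν(x)` of the normal map `(x, y) ↦ x + y ν(x)`. -/
structure IsNormalInverse (Ω : Set (EuclideanSpace ℝ (Fin n))) (x : EuclideanSpace ℝ (Fin n))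
    (y : ℝ) (P : EuclideanSpace ℝ (Fin n) → EuclideanSpace ℝ (Fin n) × ℝ) : Prop where
  smooth : ContDiffAt ℝ ∞ P (x + y • outwardNormal Ω x)
  apply_eq : P (x + y • outwardNormal Ω x) = (x, y)
  eventually_eq : ∀ᶠ z in 𝓝 (x + y • outwardNormal Ω x),
    (P z).1 ∈ frontier Ω ∧ z = (P z).1 + (P z).2 • outwardNormal Ω (P z).1

/-- Differentiate z = P₁ + P₂ N(P₁) and pair with N. The DP₁ term vanishes because ρ(P₁) = 0, the DN
term because |N| = 1, which leaves dP₂(w) = ⟨N, w⟩. -/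
theorem IsNormalInverse.gradient_snd (hΩ : IsSmoothBoundedDomain Ω)
    {x : EuclideanSpace ℝ (Fin n)} (hx : x ∈ frontier Ω) {y : ℝ}
    {P : EuclideanSpace ℝ (Fin n) → EuclideanSpace ℝ (Fin n) × ℝ} (hP : IsNormalInverse Ω x y P) :
    ∇ (fun z => (P z).2) (x + y • outwardNormal Ω x) = outwardNormal Ω x := by
  obtain ⟨ρ, h⟩ := hΩ.smooth_boundary x hx
  have hνx := h.outwardNormal_eq_normalField hx
  set z₀ := x + y • outwardNormal Ω x with hz₀
  have hPd := hP.smooth.differentiableAt (by simp)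
  have h1 : HasFDerivAt (fun z => (P z).1) (fderiv ℝ (fun z => (P z).1) z₀) z₀ :=
    hPd.fst.hasFDerivAt
  have h2 : HasFDerivAt (fun z => (P z).2) (fderiv ℝ (fun z => (P z).2) z₀) z₀ :=
    hPd.snd.hasFDerivAt
  set A := fderiv ℝ (fun z => (P z).1) z₀
  set B := fderiv ℝ (fun z => (P z).2) z₀ with hB
  have hP1 : (P z₀).1 = x := by rw [hP.apply_eq]
  have hP2 : (P z₀).2 = y := by rw [hP.apply_eq]
  have hev : ∀ᶠ z in 𝓝 z₀, IsLocalDefiningFunction Ω (P z).1 ρ := by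
    have : Tendsto (fun z => (P z).1) (𝓝 z₀) (𝓝 x) := by
      have := h1.continuousAt.tendsto
      rwa [hP1] at this
    exact this.eventually h.eventually
  have hρ : HasFDerivAt ρ (fderiv ℝ ρ x) ((fun z => (P z).1) z₀) := by
    simp only [hP1]
    exact (h.contDiffAt.differentiableAt (by simp)).hasFDerivAt
  have hN : HasFDerivAt (normalField ρ) (fderiv ℝ (normalField ρ) x) ((fun z => (P z).1) z₀) := by
    simp only [hP1]
    exact (h.contDiffAt_normalField.differentiableAt (by simp)).hasFDerivAt
  have hA : ∀ w, inner ℝ (normalField ρ x) (A w) = 0 := fun w => by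
    have hc : HasFDerivAt (ρ ∘ fun z => (P z).1) (0 : EuclideanSpace ℝ (Fin n) →L[ℝ] ℝ) z₀ := by
      refine (hasFDerivAt_const (0 : ℝ) z₀).congr_of_eventuallyEq ?_
      filter_upwards [hev, hP.eventually_eq] with z hz1 hz2
      exact hz1.eq_zero hz2.1
    have := DFunLike.congr_fun ((hρ.comp z₀ h1).unique hc) w
    simp only [ContinuousLinearMap.comp_apply, zero_apply] at this
    rw [normalField, real_inner_smul_left, inner_gradient_eq_fderiv, this, mul_zero]
  have hid : HasFDerivAt (fun z => (P z).1 + (P z).2 • normalField ρ (P z).1)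
      (ContinuousLinearMap.id ℝ (EuclideanSpace ℝ (Fin n))) z₀ := by
    refine (hasFDerivAt_id z₀).congr_of_eventuallyEq ?_
    filter_upwards [hev, hP.eventually_eq] with z hz1 hz2
    rw [← hz1.outwardNormal_eq_normalField hz2.1, ← hz2.2]
    rfl
  have hsum := h1.add (h2.smul (hN.comp z₀ h1))
  apply ext_inner_right ℝ
  intro w
  rw [inner_gradient_eq_fderiv, ← hB, hνx]
  have hw := congrArg (fun v => inner ℝ (normalField ρ x) v)
    (DFunLike.congr_fun (hsum.unique hid) w)
  simp only [add_apply, smul_apply,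
    ContinuousLinearMap.comp_apply, ContinuousLinearMap.smulRight_apply, Function.comp_apply,
    ContinuousLinearMap.id_apply, hP1, hP2, inner_add_right, inner_smul_right, hA,
    h.inner_normalField_fderiv, real_inner_self_eq_norm_sq, h.norm_normalField] at hw
  linarith

/-- Local normal coordinates at a boundary point. -/
theorem exists_local_normalCoordinates (hΩ : IsSmoothBoundedDomain Ω) (hp : p ∈ frontier Ω) :
    ∃ W : Set (EuclideanSpace ℝ (Fin n) × ℝ), IsOpen W ∧ (p, (0 : ℝ)) ∈ W ∧
      (∀ q ∈ W, ∀ q' ∈ W, q.1 ∈ frontier Ω → q'.1 ∈ frontier Ω →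
        q.1 + q.2 • outwardNormal Ω q.1 = q'.1 + q'.2 • outwardNormal Ω q'.1 → q = q') ∧
      ∀ q ∈ W, q.1 ∈ frontier Ω →
        (q.1 + q.2 • outwardNormal Ω q.1 ∈ Ω ↔ q.2 < 0) ∧ ∃ P, IsNormalInverse Ω q.1 q.2 P := by
  obtain ⟨ρ, h⟩ := hΩ.smooth_boundary p hp
  obtain ⟨e', he'⟩ := h.exists_equiv_fderiv_normalMap
  have hF := h.contDiffAt_normalMap 0
  have hF' : HasFDerivAt (normalMap ρ) (e' : _ →L[ℝ] _) (p, 0) := by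
    rw [he']; exact (hF.differentiableAt (by simp)).hasFDerivAt
  let e := hF.toOpenPartialHomeomorph (normalMap ρ) hF' (by simp)
  have hecoe : ∀ q, e q = normalMap ρ q := fun q => by
    rw [hF.toOpenPartialHomeomorph_coe hF' (by simp)]
  have hes : ∀ᶠ q in 𝓝 (p, (0 : ℝ)), q ∈ e.source :=
    e.open_source.mem_nhds (hF.mem_toOpenPartialHomeomorph_source hF' (by simp))
  -- Smoothness of the inverse is needed at every point of `W`, not only at the centre, so
  -- invertibility of the derivative is propagated by openness.
  have hinv : ∀ᶠ q in 𝓝 (p, (0 : ℝ)), fderiv ℝ (normalMap ρ) q ∈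
      range ((↑) : ((EuclideanSpace ℝ (Fin n) × ℝ) ≃L[ℝ] (EuclideanSpace ℝ (Fin n) × ℝ)) →
        (EuclideanSpace ℝ (Fin n) × ℝ) →L[ℝ] (EuclideanSpace ℝ (Fin n) × ℝ)) := by
    refine (hF.continuousAt_fderiv (by simp)).eventually_mem ?_
    rw [← he']
    exact ContinuousLinearEquiv.nhds e'
  have hdef : ∀ᶠ q : EuclideanSpace ℝ (Fin n) × ℝ in 𝓝 (p, (0 : ℝ)),
      IsLocalDefiningFunction Ω q.1 ρ :=
    (continuous_fst.tendsto (p, (0 : ℝ))).eventually h.eventually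
  obtain ⟨W, hW, hWo, hpW⟩ := _root_.mem_nhds_iff.mp
    (hes.and (hinv.and (hdef.and h.eventually_mem_iff_neg)))
  have hmap : ∀ q ∈ W, q.1 ∈ frontier Ω →
      normalMap ρ q = (q.1 + q.2 • outwardNormal Ω q.1, 0) := fun q hq hqf => by
    obtain ⟨-, -, hq3, -⟩ := hW hq
    rw [normalMap, hq3.outwardNormal_eq_normalField hqf, hq3.eq_zero hqf]
  refine ⟨W, hWo, hpW, fun q hq q' hq' hqf hqf' heq => ?_, fun q hq hqf => ⟨?_, ?_⟩⟩
  · refine e.injOn (hW hq).1 (hW hq').1 ?_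
    rw [hecoe, hecoe, hmap q hq hqf, hmap q' hq' hqf', heq]
  · rw [(hW hq).2.2.1.outwardNormal_eq_normalField hqf]
    exact (hW hq).2.2.2 hqf
  · obtain ⟨hq1, ⟨e₁, he₁⟩, hq3, -⟩ := hW hq
    set z₀ := q.1 + q.2 • outwardNormal Ω q.1 with hz₀
    have heq : e q = (z₀, 0) := by rw [hecoe, hmap q hq hqf]
    have ht : (z₀, (0 : ℝ)) ∈ e.target := heq ▸ e.map_source hq1
    have hsymm : e.symm (z₀, 0) = q := by rw [← heq, e.left_inv hq1]
    have hsm : ContDiffAt ℝ ∞ e.symm (z₀, 0) := by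
      have hcd : ContDiffAt ℝ ∞ (normalMap ρ) q := hq3.contDiffAt_normalMap q.2
      have hecoe' : (e : EuclideanSpace ℝ (Fin n) × ℝ → EuclideanSpace ℝ (Fin n) × ℝ) =
        normalMap ρ := funext hecoe
      refine e.contDiffAt_symm (f₀' := e₁) ht ?_ ?_
      · rw [hsymm, he₁, hecoe']
        exact (hcd.differentiableAt (by simp)).hasFDerivAt
      · rw [hsymm, hecoe']
        exact hcd
    have hPs : ContDiffAt ℝ ∞ (fun z => e.symm (z, 0)) z₀ :=
      hsm.comp z₀ (contDiffAt_id.prodMk contDiffAt_const)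
    -- Setting the ρ-component to 0 forces the foot point onto ∂Ω.
    refine ⟨fun z => e.symm (z, 0), hPs, hsymm, ?_⟩
    have hcont : Tendsto (fun z => e.symm (z, 0)) (𝓝 z₀) (𝓝 q) := by
      have := hPs.continuousAt.tendsto
      rwa [hsymm] at this
    have htar : ∀ᶠ z in 𝓝 z₀, (z, (0 : ℝ)) ∈ e.target :=
      (Continuous.prodMk_left (0 : ℝ)).continuousAt.eventually_mem (e.open_target.mem_nhds ht)
    filter_upwards [hcont.eventually_mem (hWo.mem_nhds hq), htar] with z hz1 hz2
    have hz3 := (hW hz1).2.2.1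
    have hz4 : normalMap ρ (e.symm (z, 0)) = (z, 0) := by rw [← hecoe, e.right_inv hz2]
    have hfr := hz3.mem_frontier (congrArg Prod.snd hz4)
    refine ⟨hfr, ?_⟩
    rw [hz3.outwardNormal_eq_normalField hfr]
    exact (congrArg Prod.fst hz4).symm

end LocalNormalCoordinates

end

noncomputable section

/-! ### Existence of a tubular neighbourhood. -/

section TubularNeighbourhood

open Filter Metric

variable {n : ℕ} {Ω : Set (EuclideanSpace ℝ (Fin n))}

theorem gradient_sub_const (Y : EuclideanSpace ℝ (Fin n) → ℝ) (c : ℝ)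
    (x : EuclideanSpace ℝ (Fin n)) : ∇ (fun z => Y z - c) x = ∇ Y x := by
  simp only [gradient, fderiv_sub_const]

theorem continuousOn_outwardNormal (hΩ : IsSmoothBoundedDomain Ω) :
    ContinuousOn (outwardNormal Ω) (frontier Ω) := by
  intro x hx
  obtain ⟨ρ, h⟩ := hΩ.smooth_boundary x hx
  refine h.contDiffAt_normalField.continuousAt.continuousWithinAt.congr_of_eventuallyEq ?_
    (h.outwardNormal_eq_normalField hx)
  filter_upwards [mem_nhdsWithin_of_mem_nhds h.eventually, self_mem_nhdsWithin] with z hz hzf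
  exact hz.outwardNormal_eq_normalField hzf

/-- Uniform normal coordinates around the whole boundary. -/
theorem exists_uniform_normalCoordinates (hΩ : IsSmoothBoundedDomain Ω) :
    ∃ δ ∈ Ioo (0 : ℝ) 1,
      (∀ x ∈ frontier Ω, ∀ x' ∈ frontier Ω, ∀ y ∈ Ioo (-δ) δ, ∀ y' ∈ Ioo (-δ) δ,
        x + y • outwardNormal Ω x = x' + y' • outwardNormal Ω x' → x = x' ∧ y = y') ∧
      ∀ x ∈ frontier Ω, ∀ y ∈ Ioo (-δ) δ,
        (x + y • outwardNormal Ω x ∈ Ω ↔ y < 0) ∧ ∃ P, IsNormalInverse Ω x y P := by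
  choose W hWo hpW hWinj hW using fun p : frontier Ω => exists_local_normalCoordinates hΩ p.2
  have hcov : frontier Ω ×ˢ {(0 : ℝ)} ⊆ ⋃ p, W p := by
    rintro ⟨x, y⟩ ⟨hx, hy⟩
    have hy : y = 0 := hy
    subst hy
    exact mem_iUnion.mpr ⟨⟨x, hx⟩, hpW ⟨x, hx⟩⟩
  obtain ⟨ε, hε, hball⟩ := lebesgue_number_lemma_of_metric
    (hΩ.isCompact_frontier.prod isCompact_singleton) hWo hcov
  -- If two normal segments meet, their feet are at distance at most |y| + |y'| < 2δ ≤ ε, so both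
  -- parameter pairs lie in one `W p`, where the map is injective. The cap 1/2 ensures δ < 1.
  set δ := min (ε / 2) (1 / 2) with hδ
  have hδε : 2 * δ ≤ ε := by linarith [min_le_left (ε / 2) (1 / 2)]
  have hδ0 : 0 < δ := by positivity
  have hmem : ∀ x x' : EuclideanSpace ℝ (Fin n), ∀ y ∈ Ioo (-δ) δ, dist x' x < 2 * δ →
      ((x', y) : EuclideanSpace ℝ (Fin n) × ℝ) ∈ ball (x, (0 : ℝ)) ε := fun x x' y hy hx => by
    rw [← ball_prod_same, mem_prod, Real.ball_eq_Ioo]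
    exact ⟨hx.trans_le hδε, by linarith [hy.1], by linarith [hy.2]⟩
  refine ⟨δ, ⟨hδ0, (min_le_right _ _).trans_lt (by norm_num)⟩, ?_, ?_⟩
  · intro x hx x' hx' y hy y' hy' heq
    obtain ⟨p, hp⟩ := hball (x, 0) ⟨hx, rfl⟩
    have hd : dist x' x < 2 * δ := by
      have h1 : x' - x = y • outwardNormal Ω x - y' • outwardNormal Ω x' := by
        rw [sub_eq_sub_iff_add_eq_add, ← heq, add_comm]
      rw [dist_eq_norm, h1]
      refine (norm_sub_le _ _).trans_lt ?_
      rw [norm_smul, norm_smul, norm_outwardNormal hΩ hx, norm_outwardNormal hΩ hx', mul_one,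
        mul_one, Real.norm_eq_abs, Real.norm_eq_abs]
      linarith [abs_lt.mpr hy, abs_lt.mpr hy']
    have := hWinj p (x, y) (hp (hmem x x y hy (by rw [dist_self]; linarith)))
      (x', y') (hp (hmem x x' y' hy' hd)) hx hx' heq
    exact ⟨congrArg Prod.fst this, congrArg Prod.snd this⟩
  · intro x hx y hy
    obtain ⟨p, hp⟩ := hball (x, 0) ⟨hx, rfl⟩
    exact hW p (x, y) (hp (hmem x x y hy (by rw [dist_self]; linarith))) hx

section Domains

variable {δ : ℝ} {Y : EuclideanSpace ℝ (Fin n) → ℝ}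

/-- A smooth coordinate `Y` on the tube with `Y(x + y ν(x)) = y`, negative exactly inside `Ω`. -/
structure IsTubeCoordinate (Ω : Set (EuclideanSpace ℝ (Fin n))) (δ : ℝ)
    (Y : EuclideanSpace ℝ (Fin n) → ℝ) : Prop where
  pos : 0 < δ
  domain : IsSmoothBoundedDomain Ω
  isOpen_tube : IsOpen (parallelTube Ω (-δ) δ)
  smooth : ContDiffOn ℝ ∞ Y (parallelTube Ω (-δ) δ)
  coord : ∀ x ∈ frontier Ω, ∀ y ∈ Ioo (-δ) δ, Y (x + y • outwardNormal Ω x) = y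
  gradient : ∀ x ∈ frontier Ω, ∀ y ∈ Ioo (-δ) δ,
    ∇ Y (x + y • outwardNormal Ω x) = outwardNormal Ω x
  mem_iff : ∀ z ∈ parallelTube Ω (-δ) δ, z ∈ Ω ↔ Y z < 0

/-- `Y` is chosen pointwise. By global injectivity it agrees near each point with the second
component of a local inverse, from which it inherits smoothness and its gradient. -/
theorem exists_isTubeCoordinate (hΩ : IsSmoothBoundedDomain Ω) :
    ∃ δ ∈ Ioo (0 : ℝ) 1, ∃ Y, IsTubeCoordinate Ω δ Y := by
  obtain ⟨δ, hδ, hinj, hloc⟩ := exists_uniform_normalCoordinates hΩ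
  have hex : ∀ z ∈ parallelTube Ω (-δ) δ, ∃ y ∈ Ioo (-δ) δ, ∃ x ∈ frontier Ω,
      z = x + y • outwardNormal Ω x := fun z hz => by
    simp only [parallelTube, mem_iUnion, exists_prop] at hz
    obtain ⟨y, hy, x, hx, rfl⟩ := hz
    exact ⟨y, hy, x, hx, rfl⟩
  choose! Y hY hYx using hex
  have hcoord : ∀ x ∈ frontier Ω, ∀ y ∈ Ioo (-δ) δ, Y (x + y • outwardNormal Ω x) = y := by
    intro x hx y hy
    have hz := add_smul_outwardNormal_mem_tube hx hy
    obtain ⟨x', hx', heq⟩ := hYx _ hz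
    exact (hinj x hx x' hx' y hy _ (hY _ hz) heq).2.symm
  have hev : ∀ x ∈ frontier Ω, ∀ y ∈ Ioo (-δ) δ, ∀ P, IsNormalInverse Ω x y P →
      ∀ᶠ z in 𝓝 (x + y • outwardNormal Ω x), z ∈ parallelTube Ω (-δ) δ ∧ Y z = (P z).2 := by
    intro x hx y hy P hP
    have hc : ContinuousAt (fun z => (P z).2) (x + y • outwardNormal Ω x) :=
      hP.smooth.continuousAt.snd
    have hm : ∀ᶠ z in 𝓝 (x + y • outwardNormal Ω x), (P z).2 ∈ Ioo (-δ) δ := by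
      refine hc.eventually_mem (isOpen_Ioo.mem_nhds ?_)
      rwa [hP.apply_eq]
    filter_upwards [hm, hP.eventually_eq] with z h1 h2
    rw [h2.2]
    refine ⟨add_smul_outwardNormal_mem_tube h2.1 h1, ?_⟩
    rw [hcoord _ h2.1 _ h1, ← h2.2]
  refine ⟨δ, hδ, Y, hδ.1, hΩ, ?_, ?_, hcoord, ?_, ?_⟩
  · rw [isOpen_iff_mem_nhds]
    intro z hz
    obtain ⟨x, hx, hzx⟩ := hYx z hz
    obtain ⟨P, hP⟩ := (hloc x hx _ (hY z hz)).2
    rw [hzx]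
    exact (hev x hx _ (hY z hz) P hP).mono fun _ h => h.1
  · intro z hz
    obtain ⟨x, hx, hzx⟩ := hYx z hz
    obtain ⟨P, hP⟩ := (hloc x hx _ (hY z hz)).2
    have h1 := hev x hx _ (hY z hz) P hP
    have h2 := hP.smooth.snd
    rw [← hzx] at h1 h2
    exact (h2.congr_of_eventuallyEq (h1.mono fun _ h => h.2)).contDiffWithinAt
  · intro x hx y hy
    obtain ⟨P, hP⟩ := (hloc x hx y hy).2
    have h1 : Y =ᶠ[𝓝 (x + y • outwardNormal Ω x)] fun z => (P z).2 :=
      (hev x hx y hy P hP).mono fun _ h => h.2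
    have h2 : ∇ Y (x + y • outwardNormal Ω x) =
        ∇ (fun z => (P z).2) (x + y • outwardNormal Ω x) := by
      simp only [gradient, h1.fderiv_eq]
    rw [h2, hP.gradient_snd hΩ hx]
  · intro z hz
    obtain ⟨x, hx, hzx⟩ := hYx z hz
    rw [hzx, (hloc x hx _ (hY z hz)).1, hcoord x hx _ (hY z hz)]

namespace IsTubeCoordinate

theorem isCompact_preimage (h : IsTubeCoordinate Ω δ Y) {c d : ℝ} (hcd : Icc c d ⊆ Ioo (-δ) δ) :
    IsCompact (parallelTube Ω (-δ) δ ∩ Y ⁻¹' Icc c d) :=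
  isCompact_parallelTube_inter_preimage h.domain.isCompact_frontier
    (continuousOn_outwardNormal h.domain) h.coord hcd

theorem mem_iUnion_iff (h : IsTubeCoordinate Ω δ Y) {I : Set ℝ} (hI : I ⊆ Ioo (-δ) δ)
    {z : EuclideanSpace ℝ (Fin n)} : z ∈ ⋃ s ∈ I, parallelSurface Ω s ↔
      z ∈ parallelTube Ω (-δ) δ ∧ Y z ∈ I := by
  simp only [mem_iUnion, exists_prop]
  constructor
  · rintro ⟨s, hs, hz⟩
    rw [parallelSurface_eq_tube_inter h.coord (hI hs)] at hz
    exact ⟨hz.1, (show Y z = s from hz.2) ▸ hs⟩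
  · rintro ⟨hz, hzI⟩
    refine ⟨Y z, hzI, ?_⟩
    rw [parallelSurface_eq_tube_inter h.coord (hI hzI)]
    exact ⟨hz, rfl⟩

/-- Inside the tube Ω_y is the sublevel set of `Y`, outside it is Ω unchanged; the topology of Ω_y
is read off from this description. -/
theorem mem_parallelDomain (h : IsTubeCoordinate Ω δ Y) {y : ℝ} (hy : y ∈ Ioo (-δ) δ)
    {z : EuclideanSpace ℝ (Fin n)} :
    z ∈ parallelDomain Ω y ↔ (z ∈ parallelTube Ω (-δ) δ ∧ Y z < y) ∨
      (z ∉ parallelTube Ω (-δ) δ ∧ z ∈ Ω) := by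
  have h1 : Ico y 0 ⊆ Ioo (-δ) δ := fun s hs => ⟨hy.1.trans_le hs.1, hs.2.trans h.pos⟩
  have h2 : Ico 0 y ⊆ Ioo (-δ) δ := fun s hs =>
    ⟨(neg_lt_zero.mpr h.pos).trans_le hs.1, hs.2.trans hy.2⟩
  rw [parallelDomain, mem_union, Set.mem_sdiff, h.mem_iUnion_iff h1, h.mem_iUnion_iff h2]
  by_cases hz : z ∈ parallelTube Ω (-δ) δ
  · simp only [hz, true_and, not_true_eq_false, false_and, or_false, h.mem_iff z hz, mem_Ico,
      not_and, not_lt]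
    constructor
    · rintro (⟨h3, h4⟩ | ⟨-, h4⟩)
      · by_contra h5
        exact (h4 (not_lt.mp h5)).not_gt h3
      · exact h4
    · intro h3
      rcases lt_or_ge (Y z) 0 with h4 | h4
      · exact Or.inl ⟨h4, fun h5 => absurd h3 h5.not_gt⟩
      · exact Or.inr ⟨h4, h3⟩
  · simp [hz]

theorem zero_mem (h : IsTubeCoordinate Ω δ Y) : (0 : ℝ) ∈ Ioo (-δ) δ :=
  ⟨neg_lt_zero.mpr h.pos, h.pos⟩

theorem eventually_mem_tube (h : IsTubeCoordinate Ω δ Y) {z : EuclideanSpace ℝ (Fin n)}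
    (hz : z ∈ parallelTube Ω (-δ) δ) : ∀ᶠ w in 𝓝 z, w ∈ parallelTube Ω (-δ) δ :=
  h.isOpen_tube.mem_nhds hz

theorem continuousAt (h : IsTubeCoordinate Ω δ Y) {z : EuclideanSpace ℝ (Fin n)}
    (hz : z ∈ parallelTube Ω (-δ) δ) : ContinuousAt Y z :=
  (h.smooth.contDiffAt (h.isOpen_tube.mem_nhds hz)).continuousAt

theorem isOpen_parallelDomain (h : IsTubeCoordinate Ω δ Y) {y : ℝ} (hy : y ∈ Ioo (-δ) δ) :
    IsOpen (parallelDomain Ω y) := by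
  rw [isOpen_iff_mem_nhds]
  intro z hz
  rw [h.mem_parallelDomain hy] at hz
  rcases hz with ⟨hzW, hzy⟩ | ⟨hzW, hzΩ⟩
  · filter_upwards [h.eventually_mem_tube hzW, (h.continuousAt hzW).eventually_lt_const hzy]
      with w h1 h2
    exact (h.mem_parallelDomain hy).mpr (Or.inl ⟨h1, h2⟩)
  -- Near a point of Ω off the tube, the only points of Ω that could be missing from Ω_y have Y ∈
  -- [min(y, 0), 0]. They form a compact set that avoids the point.
  · have hsub : Icc (min y 0) 0 ⊆ Ioo (-δ) δ := fun s hs =>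
      ⟨(lt_min hy.1 h.zero_mem.1).trans_le hs.1, hs.2.trans_lt h.pos⟩
    have hK := (h.isCompact_preimage hsub).isClosed.isOpen_compl
    filter_upwards [h.domain.isOpen.mem_nhds hzΩ, hK.mem_nhds fun hz => hzW hz.1] with w h1 h2
    rw [h.mem_parallelDomain hy]
    by_cases hw : w ∈ parallelTube Ω (-δ) δ
    · refine Or.inl ⟨hw, ?_⟩
      by_contra h3
      exact h2 ⟨hw, (min_le_left _ _).trans (not_lt.mp h3), ((h.mem_iff w hw).mp h1).le⟩
    · exact Or.inr ⟨hw, h1⟩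

theorem frontier_subset_tube (h : IsTubeCoordinate Ω δ Y) :
    frontier Ω ⊆ parallelTube Ω (-δ) δ := by
  rw [← parallelSurface_zero]
  exact parallelSurface_subset_tube h.zero_mem

theorem closure_parallelDomain_subset (h : IsTubeCoordinate Ω δ Y) {y : ℝ}
    (hy : y ∈ Ioo (-δ) δ) {z : EuclideanSpace ℝ (Fin n)}
    (hz : z ∈ closure (parallelDomain Ω y)) :
    (z ∈ parallelTube Ω (-δ) δ ∧ Y z ≤ y) ∨ (z ∉ parallelTube Ω (-δ) δ ∧ z ∈ Ω) := by
  by_contra hcon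
  rw [not_or, not_and, not_and, not_le] at hcon
  rw [mem_closure_iff_frequently] at hz
  refine hz ?_
  by_cases hzW : z ∈ parallelTube Ω (-δ) δ
  · filter_upwards [h.eventually_mem_tube hzW,
      (h.continuousAt hzW).eventually_const_lt (hcon.1 hzW)] with w h1 h2 h3
    rw [h.mem_parallelDomain hy] at h3
    rcases h3 with h3 | h3
    · exact h3.2.not_gt h2
    · exact h3.1 h1
  · have hzc : z ∉ closure Ω := fun hzc => by
      rw [closure_eq_self_union_frontier] at hzc
      exact hzc.elim (hcon.2 hzW) fun hf => hzW (h.frontier_subset_tube hf)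
    -- Points of Ω_y outside Ω lie in the compact slab 0 ≤ Y ≤ max(y, 0), so they cannot accumulate
    -- at a point off the tube.
    have hsub : Icc 0 (max y 0) ⊆ Ioo (-δ) δ := fun s hs =>
      ⟨h.zero_mem.1.trans_le hs.1, hs.2.trans_lt (max_lt hy.2 h.pos)⟩
    have hK := (h.isCompact_preimage hsub).isClosed.isOpen_compl
    filter_upwards [isClosed_closure.isOpen_compl.mem_nhds hzc, hK.mem_nhds fun hz => hzW hz.1]
      with w h1 h2 h3
    have hwΩ : w ∉ Ω := fun hw => h1 (subset_closure hw)
    rw [h.mem_parallelDomain hy] at h3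
    rcases h3 with h3 | h3
    · have h4 : 0 ≤ Y w := not_lt.mp fun h5 => hwΩ ((h.mem_iff w h3.1).mpr h5)
      exact h2 ⟨h3.1, h4, h3.2.le.trans (le_max_left _ _)⟩
    · exact hwΩ h3.2

theorem frontier_parallelDomain (h : IsTubeCoordinate Ω δ Y) {y : ℝ} (hy : y ∈ Ioo (-δ) δ) :
    frontier (parallelDomain Ω y) = parallelSurface Ω y := by
  rw [(h.isOpen_parallelDomain hy).frontier_eq]
  apply Subset.antisymm
  · rintro z ⟨hz, hzn⟩
    rw [h.mem_parallelDomain hy, not_or] at hzn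
    rcases h.closure_parallelDomain_subset hy hz with h1 | h1
    · rw [parallelSurface_eq_tube_inter h.coord hy]
      exact ⟨h1.1, le_antisymm h1.2 (not_lt.mp fun h2 => hzn.1 ⟨h1.1, h2⟩)⟩
    · exact absurd h1 hzn.2
  · rintro z ⟨x, hx, rfl⟩
    refine ⟨?_, fun hz => ?_⟩
    · have hlim : Tendsto (fun s : ℝ => x + s • outwardNormal Ω x) (𝓝[<] y)
          (𝓝 (x + y • outwardNormal Ω x)) := by
        have : Continuous fun s : ℝ => x + s • outwardNormal Ω x := by fun_prop
        exact (this.tendsto y).mono_left nhdsWithin_le_nhds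
      refine mem_closure_of_tendsto hlim ?_
      filter_upwards [self_mem_nhdsWithin, mem_nhdsWithin_of_mem_nhds (isOpen_Ioo.mem_nhds hy)]
        with s h1 h2
      refine (h.mem_parallelDomain hy).mpr (Or.inl ⟨add_smul_outwardNormal_mem_tube hx h2, ?_⟩)
      rw [h.coord x hx s h2]
      exact h1
    · rw [h.mem_parallelDomain hy] at hz
      rcases hz with hz | hz
      · rw [h.coord x hx y hy] at hz
        exact hz.2.false
      · exact hz.1 (add_smul_outwardNormal_mem_tube hx hy)

theorem isLocalDefiningFunction (h : IsTubeCoordinate Ω δ Y) {x : EuclideanSpace ℝ (Fin n)}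
    (hx : x ∈ frontier Ω) {y : ℝ} (hy : y ∈ Ioo (-δ) δ) :
    IsLocalDefiningFunction (parallelDomain Ω y) (x + y • outwardNormal Ω x)
      (fun z => Y z - y) := by
  refine ⟨parallelTube Ω (-δ) δ, h.isOpen_tube, add_smul_outwardNormal_mem_tube hx hy,
    h.smooth.sub contDiffOn_const, fun z hz => ?_, fun z hz => ?_⟩
  · obtain ⟨hy', x', hx', hzx⟩ := exists_eq_of_mem_parallelTube h.coord hz
    rw [gradient_sub_const, hzx, h.gradient x' hx' _ hy', ← norm_ne_zero_iff,
      norm_outwardNormal h.domain hx']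
    exact one_ne_zero
  · rw [h.mem_parallelDomain hy, sub_neg]
    simp [hz]

theorem isSmoothBoundedDomain (h : IsTubeCoordinate Ω δ Y) {y : ℝ} (hy : y ∈ Ioo (-δ) δ) :
    IsSmoothBoundedDomain (parallelDomain Ω y) where
  isOpen := h.isOpen_parallelDomain hy
  isBounded := by
    refine ((isBounded_parallelTube (a := -δ) (b := δ) h.domain.isCompact_frontier fun _ hx =>
      norm_outwardNormal h.domain hx).union h.domain.isBounded).subset fun z hz => ?_
    rw [h.mem_parallelDomain hy] at hz
    exact hz.imp And.left And.right
  smooth_boundary p hp := by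
    rw [h.frontier_parallelDomain hy] at hp
    obtain ⟨x, hx, rfl⟩ := hp
    exact ⟨_, h.isLocalDefiningFunction hx hy⟩

theorem isTubularFoliation (h : IsTubeCoordinate Ω δ Y) : IsTubularFoliation Ω (-δ) δ where
  left_neg := h.zero_mem.1
  right_pos := h.pos
  smooth_domain y hy := h.isSmoothBoundedDomain hy
  boundary y hy := h.frontier_parallelDomain hy
  expanding y hy z hz hyz w hw := by
    rw [h.mem_parallelDomain hz]
    exact (h.closure_parallelDomain_subset hy hw).imp_left fun h1 => ⟨h1.1, h1.2.trans_lt hyz⟩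
  isOpen_tube := h.isOpen_tube
  coordinate := ⟨Y, h.smooth, h.coord⟩
  normal x hx y hy := by
    have hf : x + y • outwardNormal Ω x ∈ frontier (parallelDomain Ω y) := by
      rw [h.frontier_parallelDomain hy]
      exact ⟨x, hx, rfl⟩
    rw [(h.isLocalDefiningFunction hx hy).outwardNormal_eq hf, gradient_sub_const,
      h.gradient x hx y hy, norm_outwardNormal h.domain hx, inv_one, one_smul]

end IsTubeCoordinate

end Domains

/-- The boundary of a smooth bounded domain has a tubular neighbourhood. -/
theorem exists_isTubularFoliation (hΩ : IsSmoothBoundedDomain Ω) :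
    ∃ δ ∈ Ioo (0 : ℝ) 1, IsTubularFoliation Ω (-δ) δ := by
  obtain ⟨δ, hδ, Y, h⟩ := exists_isTubeCoordinate hΩ
  exact ⟨δ, hδ, h.isTubularFoliation⟩

end TubularNeighbourhood

end

theorem mainTheorem2 {n D : ℕ}
    (f : EuclideanSpace ℝ (Fin D) → Fin D → EuclideanSpace ℝ (Fin n)) (hf : Continuous f)
    (u₀ : EuclideanSpace ℝ (Fin n) → EuclideanSpace ℝ (Fin D))
    (hu₀_one : MemLp u₀ 1 volume) (hu₀_top : MemLp u₀ ⊤ volume)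
    (u : EuclideanSpace ℝ (Fin n) → ℝ → EuclideanSpace ℝ (Fin D))
    (hu : IsWeakSolution f u)
    (hinit : (fun x => u x 0) =ᵐ[volume] u₀)
    (hbdd : IsLocallyBounded u)
    (hmass : HasContinuousMass u)
    (Ω : Set (EuclideanSpace ℝ (Fin n))) (hΩ : IsSmoothBoundedDomain Ω) :
    -- the geometric construction is possible on some interval around `0`
    (∃ δ ∈ Ioo (0 : ℝ) 1, IsTubularFoliation Ω (-δ) δ) ∧
    -- and on every interval on which it is possible the flux trace is Lipschitz continuous
    ∀ a b : ℝ, IsTubularFoliation Ω a b → ∀ t₁ t₂ : ℝ, 0 ≤ t₁ → t₁ < t₂ →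
      -- the flux integrals exist for almost every `y`
      (∀ᵐ y ∂(volume.restrict (Ioo a b)), ∀ i : Fin D,
        Integrable
          (fun p : EuclideanSpace ℝ (Fin n) × ℝ => fluxDensity f u Ω y i p.1 p.2)
          ((surfaceMeasure Ω y).prod (volume.restrict (Icc t₁ t₂)))) ∧
      -- the trace coincides almost everywhere with a Lipschitz function on the whole interval
      (∃ (H : ℝ → EuclideanSpace ℝ (Fin D)) (L : NNReal), LipschitzOnWith L H (Ioo a b) ∧
        ∀ᵐ y ∂(volume.restrict (Ioo a b)), fluxTrace f u Ω t₁ t₂ y = H y) ∧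
      -- its distributional derivative is a bounded function
      (∃ r : ℝ → EuclideanSpace ℝ (Fin D), MemLp r ⊤ (volume.restrict (Ioo a b)) ∧
        ∀ θ : ℝ → ℝ, ContDiff ℝ ∞ θ → HasCompactSupport θ → tsupport θ ⊆ Ioo a b →
          ∫ y in Ioo a b, deriv θ y • fluxTrace f u Ω t₁ t₂ y = -∫ y in Ioo a b, θ y • r y) := by
  exact ⟨exists_isTubularFoliation hΩ, fun _ _ hfol _ _ ht₁ ht =>
    hfol.fluxTrace_lipschitz hΩ hu hbdd hmass ht₁ ht⟩
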